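/- **Syntax.** Let $\Sigma=(\mathsf O,\mathsf C,\mathsf R)$ be a signature of individuals, concept symbols and role symbols. Concepts and roles of $\mathcal{ALBO}^{\mathrm{id}}$ are given by $C,D::=A\mid\{a\}\mid\neg C\mid C\sqcup D\mid\exists R.C$ and $R,S::=Q\mid R\sqcup S\mid R^{-1}\mid\neg R\mid\mathrm{id}$ ($A\in\mathsf C$, $a\in\mathsf O$, $Q\in\mathsf R$). **Rules.** The calculus works on sets of labelled concepts $a:C$ and has the following rules ($X_0\,/\,X_1\mid\dots\mid X_n$ means premises $X_0$ and alternative sets of conclusions $X_i$; the first rule is the closure rule, $n=0$): - ($\bot$) $a:C,\ a:\neg C\,/\,\bot$; ($\neg\neg$) $a:\neg\neg C\,/\,a:C$; ($\neg\sqcup$) $a:\neg(C\sqcup D)\,/\,a:\neg C,\ a:\neg D$; ($\sqcup$) $a:C\sqcup D\,/\,a:C\mid a:D$; - ($\exists$) $a:\exists R.C\,/\,a:\exists R.\{a'\},\ a':C$ with $a'$ new in the branch, applied only if $C$ is not a singleton concept $\{a''\}$; ($\neg\exists$) $a:\neg\exists R.C,\ a:\exists R.\{a'\}\,/\,a':\neg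 C$; - (sym) $a:\{a'\}\,/\,a':\{a\}$; ($\neg$sym) $a:\neg\{a'\}\,/\,a':\neg\{a\}$; (mon) $a:\{a'\},\ a':C\,/\,a:C$; (refl) $a:C\,/\,a:\{a\}$; - ($\exists\sqcup$) $a:\exists(R\sqcup S).\{a'\}\,/\,a:\exists R.\{a'\}\mid a:\exists S.\{a'\}$; ($\neg\exists\sqcup$) $a:\neg\exists(R\sqcup S).C\,/\,a:\neg\exists R.C,\ a:\neg\exists S.C$; - ($\exists^{-1}$) $a:\exists R^{-1}.\{a'\}\,/\,a':\exists R.\{a\}$; ($\neg\exists^{-1}$) $a:\neg\exists R^{-1}.C,\ a':\exists R.\{a\}\,/\,a':\neg C$; - ($\exists\neg$) $a:\exists\neg R.\{a'\}\,/\,a:\neg\exists R.\{a'\}$; ($\neg\exists\neg$) $a:\neg\exists\neg R.C,\ a':\{a'\}\,/\,a:\exists R.\{a'\}\mid a':\neg C$; - ($\exists\mathrm{id}$) $a:\exists\mathrm{id}.\{a'\}\,/\,a:\{a'\}$; ($\neg\exists\mathrm{id}$) $a:\neg\exists\mathrm{id}.C\,/\,a:\neg C$; - (ub) $a:\{a\},\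 a':\{a'\}\,/\,a:\{a'\}\mid a:\neg\{a'\}$ (unrestricted blocking). **Tableaux.** Let $\mathcal S$ be a set of concepts, and let $\mathcal S'$ be obtained from it by pushing role inverse inward exhaustively with $(R\sqcup S)^{-1}=R^{-1}\sqcup S^{-1}$, $(\neg R)^{-1}=\neg(R^{-1})$, $(R^{-1})^{-1}=R$, $\mathrm{id}^{-1}=\mathrm{id}$. A derivation for $\mathcal S$ is a finitely branching ordered tree whose nodes are sets of labelled concepts. Its root is $\{a_0:C\mid C\in\mathcal S'\}$ with $a_0$ fresh. A node is expanded by applying one rule instance with premises in the node, which creates one successor for each $X_i$, namely the node together with $X_i$; in a branch no rule is applied twice to the same instance of its premises (matched in order). A branch is a maximal path from the root; it is closed if the closure rule has been applied in it (it then ends there) and open otherwise. A derivation is closed if all its branches are closed, and open otherwise. For every branch let $<$ be a strict linear ordering of the individuals occurring in the branch such that $a<a'$ whenever the first appearance of $a$ in the branch is strictly earlier than that of $a'$. A *tableau for $\mathcal S$ in $T_{\mathcal{ALBO}^{\mathrm{id}}}(\mathrm{ub})$* is a derivation for $\mathcal S$ such that, for suitable such orderings: - (c1) in every branch, ($\exists$)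 is not applied to $a':\exists R.C$ at a node containing $a:\{a'\}$ for some $a<a'$; - (c2) in every open branch there is a node from which point onwards, before any application of ($\exists$) at a node, (ub) has been performed for all ordered pairs $(a,a')$ of individuals that label some expression in that node; - every open branch is fully expanded: every rule instance with premises in the branch has been performed in the branch, except the ($\exists$)-instances $a':\exists R.C$ for which $a:\{a'\}$ is in the branch for some $a<a'$. Here a rule instance counts as performed if it has been applied, or, for rules other than ($\exists$), if one of its alternative sets of conclusions is already present. **Theorem (Termination).** $T_{\mathcal{ALBO}^{\mathrm{id}}}(\mathrm{ub})$ is terminating for satisfiability in $\mathcal{ALBO}^{\mathrm{id}}$: for every finite set $\mathcal S$ of concepts, every closed tableau for $\mathcal S$ is finite, and every open tableau for $\mathcal S$ has a finite open branch. -/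

import Mathlib

namespace ALBO

/-! Syntax over a signature: `O` individuals, `A` concept symbols, `Q` role symbols. -/

/-- Role expressions of ALBO^id. -/
inductive Role (Q : Type*) where
  | sym : Q → Role Q
  | union : Role Q → Role Q → Role Q
  | inv : Role Q → Role Q
  | neg : Role Q → Role Q
  | id : Role Q

/-- Concept expressions of ALBO^id; `sing a` is the singleton concept `{a}`. -/
inductive Concept (O A Q : Type*) where
  | sym : A → Concept O A Q
  | sing : O → Concept O A Q
  | neg : Concept O A Q → Concept O A Q
  | union : Concept O A Q → Concept O A Q → Concept O A Q
  | ex : Role Q → Concept O A Q → Concept O A Q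

/-- Labelled concept expressions `a : C`, written `a ⦂ C`. -/
structure Labelled (O A Q : Type*) where
  ind : O
  con : Concept O A Q

infix:60 " ⦂ " => Labelled.mk

/-- The individual `a` occurs in a concept. -/
def Concept.Occurs {O A Q : Type*} (a : O) : Concept O A Q → Prop
  | .sym _ => False
  | .sing b => a = b
  | .neg C => C.Occurs a
  | .union C D => C.Occurs a ∨ D.Occurs a
  | .ex _ C => C.Occurs a

def Concept.IsSingleton {O A Q : Type*} (C : Concept O A Q) : Prop :=
  ∃ a, C = .sing a

/-- The individual `a` occurs (as a label or inside a concept) in a set of labelled concepts. -/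
def OccursIn {O A Q : Type*} (a : O) (N : Set (Labelled O A Q)) : Prop :=
  ∃ E ∈ N, a = E.ind ∨ E.con.Occurs a

/-- The individual `a` labels some expression of `N`. -/
def IsLabel {O A Q : Type*} (a : O) (N : Set (Labelled O A Q)) : Prop :=
  ∃ C, (a ⦂ C) ∈ N

/-! Preprocessing: the inverse operator is pushed inward by
`(R ⊔ S)⁻¹ = R⁻¹ ⊔ S⁻¹`, `(¬R)⁻¹ = ¬(R⁻¹)`, `(R⁻¹)⁻¹ = R`, `id⁻¹ = id`. -/

/-- `pushInv false R` is the normal form of `R`, and `pushInv true R` that of `R⁻¹`, under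
exhaustive left-to-right application of these equations. -/
def Role.pushInv {Q : Type*} : Bool → Role Q → Role Q
  | false, .sym q => .sym q
  | true, .sym q => .inv (.sym q)
  | b, .union R S => .union (R.pushInv b) (S.pushInv b)
  | b, .inv R => R.pushInv (!b)
  | b, .neg R => .neg (R.pushInv b)
  | _, .id => .id

def Concept.preprocess {O A Q : Type*} : Concept O A Q → Concept O A Q
  | .sym p => .sym p
  | .sing a => .sing a
  | .neg C => .neg C.preprocess
  | .union C D => .union C.preprocess D.preprocess
  | .ex R C => .ex (R.pushInv false) C.preprocess

/-! The rules. -/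

/-- A rule of the calculus together with an instantiation of its premises. -/
inductive RuleInst (O A Q : Type*) where
  | clash (a : O) (C : Concept O A Q)
  | notNot (a : O) (C : Concept O A Q)
  | notOr (a : O) (C D : Concept O A Q)
  | or (a : O) (C D : Concept O A Q)
  | ex (a : O) (R : Role Q) (C : Concept O A Q)
  | notEx (a : O) (R : Role Q) (C : Concept O A Q) (a' : O)
  | sym (a a' : O)
  | notSym (a a' : O)
  | mon (a a' : O) (C : Concept O A Q)
  | refl (a : O) (C : Concept O A Q)
  | exOr (a : O) (R S : Role Q) (a' : O)
  | notExOr (a : O) (R S : Role Q) (C : Concept O A Q)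
  | exInv (a : O) (R : Role Q) (a' : O)
  | notExInv (a : O) (R : Role Q) (C : Concept O A Q) (a' : O)
  | exNot (a : O) (R : Role Q) (a' : O)
  | notExNot (a : O) (R : Role Q) (C : Concept O A Q) (a' : O)
  | exId (a a' : O)
  | notExId (a : O) (C : Concept O A Q)
  | ub (a a' : O)

namespace RuleInst

variable {O A Q : Type*}

/-- The instantiated premises. -/
def premises : RuleInst O A Q → Set (Labelled O A Q)
  | clash a C => {a ⦂ C, a ⦂ .neg C}
  | notNot a C => {a ⦂ .neg (.neg C)}
  | notOr a C D => {a ⦂ .neg (.union C D)}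
  | or a C D => {a ⦂ .union C D}
  | ex a R C => {a ⦂ .ex R C}
  | notEx a R C a' => {a ⦂ .neg (.ex R C), a ⦂ .ex R (.sing a')}
  | sym a a' => {a ⦂ .sing a'}
  | notSym a a' => {a ⦂ .neg (.sing a')}
  | mon a a' C => {a ⦂ .sing a', a' ⦂ C}
  | refl a C => {a ⦂ C}
  | exOr a R S a' => {a ⦂ .ex (.union R S) (.sing a')}
  | notExOr a R S C => {a ⦂ .neg (.ex (.union R S) C)}
  | exInv a R a' => {a ⦂ .ex (.inv R) (.sing a')}
  | notExInv a R C a' => {a ⦂ .neg (.ex (.inv R) C), a' ⦂ .ex R (.sing a)}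
  | exNot a R a' => {a ⦂ .ex (.neg R) (.sing a')}
  | notExNot a R C a' => {a ⦂ .neg (.ex (.neg R) C), a' ⦂ .sing a'}
  | exId a a' => {a ⦂ .ex .id (.sing a')}
  | notExId a C => {a ⦂ .neg (.ex .id C)}
  | ub a a' => {a ⦂ .sing a, a' ⦂ .sing a'}

/-- The list `X₁ | … | Xₙ` of alternative sets of conclusions (empty for the closure rule);
`w` is the new individual, used by the rule `ex` only. -/
def conclusions (w : O) : RuleInst O A Q → List (Set (Labelled O A Q))
  | clash _ _ => []
  | notNot a C => [{a ⦂ C}]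
  | notOr a C D => [{a ⦂ .neg C, a ⦂ .neg D}]
  | or a C D => [{a ⦂ C}, {a ⦂ D}]
  | ex a R C => [{a ⦂ .ex R (.sing w), w ⦂ C}]
  | notEx _ _ C a' => [{a' ⦂ .neg C}]
  | sym a a' => [{a' ⦂ .sing a}]
  | notSym a a' => [{a' ⦂ .neg (.sing a)}]
  | mon a _ C => [{a ⦂ C}]
  | refl a _ => [{a ⦂ .sing a}]
  | exOr a R S a' => [{a ⦂ .ex R (.sing a')}, {a ⦂ .ex S (.sing a')}]
  | notExOr a R S C => [{a ⦂ .neg (.ex R C), a ⦂ .neg (.ex S C)}]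
  | exInv a R a' => [{a' ⦂ .ex R (.sing a)}]
  | notExInv _ _ C a' => [{a' ⦂ .neg C}]
  | exNot a R a' => [{a ⦂ .neg (.ex R (.sing a'))}]
  | notExNot a R C a' => [{a ⦂ .ex R (.sing a')}, {a' ⦂ .neg C}]
  | exId a a' => [{a ⦂ .sing a'}]
  | notExId a C => [{a ⦂ .neg C}]
  | ub a a' => [{a ⦂ .sing a'}, {a ⦂ .neg (.sing a')}]

/-- The closure rule. -/
def IsClosure : RuleInst O A Q → Prop
  | clash _ _ => True
  | _ => False

/-- The rule `ex`, the only one that generates new individuals. -/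
def IsEx : RuleInst O A Q → Prop
  | ex _ _ _ => True
  | _ => False

/-- The premises are available in `N`; the rule `ex` is not applied to `a : ∃R.{a''}`. -/
def Applicable (r : RuleInst O A Q) (N : Set (Labelled O A Q)) : Prop :=
  r.premises ⊆ N ∧ ∀ a R C, r = ex a R C → ¬ C.IsSingleton

/-- An application other than of `ex` is redundant if one of the alternative sets of conclusions
is already present. The rule `ex` is never redundant, since its conclusions concern a new
individual, and neither is the closure rule. -/
def Redundant (r : RuleInst O A Q) (N : Set (Labelled O A Q)) : Prop :=
  ¬ r.IsEx ∧ ∃ w, ∃ X ∈ r.conclusions w, X ⊆ N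

/-- The applications forbidden by condition (c1), relative to the ordering `lt` of individuals:
those of `ex` to `a' : ∃R.C` when `a : {a'}` is present for some `a < a'`. -/
def Blocked (lt : O → O → Prop) (N : Set (Labelled O A Q)) (r : RuleInst O A Q) : Prop :=
  ∃ a a' R C, r = ex a' R C ∧ lt a a' ∧ (a ⦂ .sing a') ∈ N

end RuleInst

/-! Tableaux. -/

/-- Positions in an ordered tree: the sequence of child indices from the root, last one first.
The root is `[]`, the `i`-th child of `p` is `i :: p`, and `p` is an ancestor of (or equal to)
`q` iff `p <:+ q`. -/
abbrev Pos := List ℕ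

/-- The data of a tableau: the nodes of the tree, the set of labelled concepts at each node, the
rule application (if any) by which a node is expanded, and the individual introduced there (of
relevance only if the rule is `ex`). -/
structure Tableau (O A Q : Type*) where
  nodes : Set Pos
  label : Pos → Set (Labelled O A Q)
  step : Pos → Option (RuleInst O A Q)
  witness : Pos → O

namespace Tableau

variable {O A Q : Type*}

/-- `T` is a tableau derivation for the input set `S`: it starts from `{a : C | C ∈ S}` with `a`
fresh (after preprocessing), and every node is either not expanded or expanded by one rule
application, which has one successor for each alternative; no rule is applied twice to the same
premises in a branch. -/
structure IsDerivation (T : Tableau O A Q) (S : Set (Concept O A Q)) : Prop where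
  root_mem : [] ∈ T.nodes
  root_label : ∃ a, (∀ C ∈ S, ¬ C.Occurs a) ∧ T.label [] = {E | ∃ C ∈ S, E = (a ⦂ C.preprocess)}
  applicable : ∀ p ∈ T.nodes, ∀ r, T.step p = some r → r.Applicable (T.label p)
  fresh : ∀ p ∈ T.nodes, ∀ r, T.step p = some r → r.IsEx → ¬ OccursIn (T.witness p) (T.label p)
  children : ∀ p i, i :: p ∈ T.nodes ↔
    p ∈ T.nodes ∧ ∃ r, T.step p = some r ∧ i < (r.conclusions (T.witness p)).length
  child_label : ∀ p ∈ T.nodes, ∀ r, T.step p = some r →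
    ∀ i X, (r.conclusions (T.witness p))[i]? = some X → T.label (i :: p) = T.label p ∪ X
  once : ∀ p ∈ T.nodes, ∀ q ∈ T.nodes, p <:+ q → p ≠ q →
    ∀ r, T.step p = some r → T.step q ≠ some r

/-- A branch: a maximal path from the root. -/
structure IsBranch (T : Tableau O A Q) (B : Set Pos) : Prop where
  subset : B ⊆ T.nodes
  root_mem : [] ∈ B
  parent_mem : ∀ i p, i :: p ∈ B → p ∈ B
  unique_child : ∀ i j p, i :: p ∈ B → j :: p ∈ B → i = j
  maximal : ∀ i p, p ∈ B → i :: p ∈ T.nodes → ∃ j, j :: p ∈ B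

/-- The union of the nodes of a branch. -/
def content (T : Tableau O A Q) (B : Set Pos) : Set (Labelled O A Q) :=
  {E | ∃ p ∈ B, E ∈ T.label p}

/-- A branch is closed if the closure rule has been applied in it, and open otherwise. -/
def ClosedBranch (T : Tableau O A Q) (B : Set Pos) : Prop :=
  ∃ p ∈ B, ∃ r, T.step p = some r ∧ r.IsClosure

def Closed (T : Tableau O A Q) : Prop :=
  ∀ B, T.IsBranch B → T.ClosedBranch B

/-- On the individuals of the branch `B`, `lt` is a strict linear ordering which extends the order
of introduction: `a < a'` if the first appearance of `a` is strictly before that of `a'`. -/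
structure IsIntroOrder (T : Tableau O A Q) (B : Set Pos) (lt : O → O → Prop) : Prop where
  irrefl : ∀ a, OccursIn a (T.content B) → ¬ lt a a
  trans : ∀ a b c, OccursIn a (T.content B) → OccursIn b (T.content B) →
    OccursIn c (T.content B) → lt a b → lt b c → lt a c
  total : ∀ a b, OccursIn a (T.content B) → OccursIn b (T.content B) → lt a b ∨ a = b ∨ lt b a
  extends_intro : ∀ a b, OccursIn b (T.content B) →
    (∃ p ∈ B, OccursIn a (T.label p) ∧ ¬ OccursIn b (T.label p)) → lt a b

/-- Condition (c1). -/
def CondC1 (T : Tableau O A Q) (B : Set Pos) (lt : O → O → Prop) : Prop :=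
  ∀ p ∈ B, ∀ r, T.step p = some r → ¬ r.Blocked lt (T.label p)

/-- Condition (c2) for the branch `B`: from some node `p₀` onwards, whenever `ex` is applied at a
node, then the rule `ub` has been performed before for all pairs of individuals labelling
expressions in that node. -/
def CondC2 (T : Tableau O A Q) (B : Set Pos) : Prop :=
  ∃ p₀ ∈ B, ∀ p ∈ B, p₀ <:+ p → ∀ r, T.step p = some r → r.IsEx →
    ∀ a a', IsLabel a (T.label p) → IsLabel a' (T.label p) →
      (∃ q, q <:+ p ∧ q ≠ p ∧ T.step q = some (.ub a a')) ∨
        (RuleInst.ub a a').Redundant (T.label p)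

/-- The branch `B` is fully expanded: every applicable rule application which is not forbidden by
(c1) has been performed (or is redundant). -/
def FullyExpanded (T : Tableau O A Q) (B : Set Pos) (lt : O → O → Prop) : Prop :=
  ∀ r : RuleInst O A Q, r.Applicable (T.content B) → ¬ r.Blocked lt (T.content B) →
    (∃ p ∈ B, T.step p = some r) ∨ r.Redundant (T.content B)

end Tableau

/-- `TableauCalculusUB S T`: `T` is a tableau `T(S)` for the input set `S` in the calculus
T_ALBO^id(ub). Closed branches are not expanded after the application of the closure rule. -/
structure TableauCalculusUB {O A Q : Type*} (S : Set (Concept O A Q)) (T : Tableau O A Q) :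
    Prop where
  derivation : T.IsDerivation S
  c1_and_expanded : ∀ B, T.IsBranch B → ∃ lt : O → O → Prop, T.IsIntroOrder B lt ∧
    T.CondC1 B lt ∧ (¬ T.ClosedBranch B → T.FullyExpanded B lt)
  c2 : ∀ B, T.IsBranch B → ¬ T.ClosedBranch B → T.CondC2 B

/-- A tableau calculus, given by its relation "`T` is a tableau for `S`", is terminating for
satisfiability if for every finite set of concepts every closed tableau is finite and every open
tableau has a finite open branch. -/
def Terminating {O A Q : Type*} (calculus : Set (Concept O A Q) → Tableau O A Q → Prop) : Prop :=
  ∀ S : Set (Concept O A Q), S.Finite → ∀ T : Tableau O A Q, calculus S T →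
    (T.Closed → T.nodes.Finite) ∧
    (¬ T.Closed → ∃ B, T.IsBranch B ∧ ¬ T.ClosedBranch B ∧ B.Finite)

end ALBO

/-!
The calculus is terminating because an open branch yields a finite "model" that guides the
construction of another open branch, which is forced to be finite by blocking.

The calculus is not complete for the usual semantics: an individual which occurs in concepts only,
as `b` in `a : ∃Q.{b}`, need not ever become a label, and then no rule makes sure that `b` obeys the
universal statements of the branch. Models are therefore replaced by Hintikka sets, that is,
sets of labelled concepts closed under the rules and free of clashes. Individuals which are not
labels are kept in them as uninterpreted names.

* The content of a fully expanded open branch is a Hintikka set (`hintikka_content`). The instances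
  of `ex` forbidden by (c1) do no harm: the introduction order is well-founded, and the rule is
  applied to the least individual equal to the blocked one.
* Hintikka sets have the finite model property (`Hintikka.exists_finite`). As there is no role
  composition, all conditions on a Hintikka set concern at most two labels at a time, so that the
  argument for the two-variable fragment of first-order logic applies: the *type* of a label is
  the set of the concepts from a finite set `Γ` which it carries, and labels are folded to a finite
  set such that each pair of elements of the latter imitates a pair of labels of the same types
  (`exists_finite_pairing`, `hintikka_foldedSet`).
* A renaming of individuals which maps the root into a Hintikka set can be extended along some branch
  (`exists_guided_branch`): for each rule application, the Hintikka set tells which alternative to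
  choose and, for `ex`, to which label the new individual is to be mapped. This branch is
  open, since its image contains no clash.
* If the Hintikka set has finitely many labels, the guided branch is finite. Individuals with the
  same image are made equal by `ub`, so that, after the node given by (c2), condition (c1)
  permits applications of `ex` to at most one individual per label of the Hintikka set, apart from
  those of the root (`finite_isEx`). Then finitely many individuals, finitely many labelled concepts
  and finitely many rule instances are available (`finite_of_finite_isEx`).

That closed tableaux are finite is König's lemma (`finite_nodes_of_closed`).
-/

namespace ALBO

/-! ### Folding pairs to a finite set -/

section Pairing

universe u v w

/-- Every set `Δ` whose elements carry one of finitely many types `tp` and which is equipped with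
finitely many operations `W · x` (choosing witnesses) can be folded to a finite set `E`. A pair
`(e, f)` of elements of `E` is an imitation of the pair `(p e f, p f e)` of elements of `Δ`; the
type of an element does not depend on the pair in which it is considered, equality is imitated
faithfully, each `e` has an `x`-witness `f` for each `x`, and all types of `Δ` are present.

This is the combinatorial core of the finite model property of the two-variable fragment. The
elements of `E` are the kings (whose type is realised only once), the court (witnesses of kings),
and three layers of representatives of the other types. The witnesses of an element of a layer are
itself, kings, and elements of the next layer in cyclic order, so that no two distinct elements of
the layers serve as witnesses for each other. This is why three layers are needed. -/
theorem exists_finite_pairing {Δ : Type u} {τ : Type v} {X : Type w} [Finite τ] [Finite X]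
    (tp : Δ → τ) (W : Δ → X → Δ) :
    ∃ (E : Type (max u v w)) (_ : Finite E) (p : E → E → Δ),
      (∀ e f g, tp (p e f) = tp (p e g)) ∧ (∀ e f, p e f = p f e ↔ e = f) ∧
      (∀ e x, ∃ f, p f e = W (p e f) x) ∧ ∀ a, ∃ e, tp (p e e) = tp a := by
  classical
  let King : Δ → Prop := fun a => ∀ b, tp b = tp a → b = a
  have king_congr : ∀ {a b}, tp a = tp b → King a → King b := by
    intro a b h ha c hc
    rw [ha c (hc.trans h.symm), ha b h.symm]
  let K := {a : Δ // King a}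
  let rep : Set.range tp → Δ := Set.rangeSplitting tp
  have tp_rep : ∀ t, tp (rep t) = t := Set.apply_rangeSplitting tp
  let T := {t : Set.range tp // ¬ King (rep t)}
  have hK : Finite K := Finite.of_injective (fun k : K => tp k.1)
    (fun k l h => Subtype.ext (l.2 _ h))
  -- an element of a layer has a type and, unless the second component is `none`, a role as
  -- `x`-witness; distinct `x` are served by distinct elements, and `none` keeps all types present
  let L := T × Option X × ZMod 3
  let Court := {kx : K × X // ¬ King (W kx.1.1 kx.2)}
  let E := K ⊕ (Court ⊕ L)
  -- the default element of `Δ` which an element of `E` imitates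
  let base : E → Δ := Sum.elim (fun k => k.1)
    (Sum.elim (fun c => W c.1.1.1 c.1.2) (fun l => rep l.1.1))
  let layer : Court ⊕ L → ZMod 3 := Sum.elim (fun _ => 0) (fun l => l.2.2)
  have mkT : ∀ {b}, ¬ King b → ¬ King (rep ⟨tp b, b, rfl⟩) := fun hb h =>
    hb (king_congr (tp_rep _) h)
  -- the element that serves as the `x`-witness of `e`
  let V : E → X → E := fun e x =>
    if h : King (W (base e) x) then Sum.inl ⟨_, h⟩ else
      match e, h with
      | Sum.inl k, h => Sum.inr (Sum.inl ⟨(k, x), h⟩)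
      | Sum.inr c, h => if W (base (Sum.inr c)) x = base (Sum.inr c) then Sum.inr c else
          Sum.inr (Sum.inr (⟨⟨tp (W (base (Sum.inr c)) x), _, rfl⟩, mkT h⟩, some x, layer c + 1))
  have king_base : ∀ e : E, King (base e) → ∃ k, e = Sum.inl k := by
    rintro (k | c | l) h
    · exact ⟨k, rfl⟩
    · exact absurd h c.2
    · exact absurd h l.1.2
  have V_king : ∀ e x (h : King (W (base e) x)), V e x = Sum.inl ⟨_, h⟩ := fun e x h => by
    simp only [V, h, dif_pos]
  have V_court : ∀ k x (h : ¬ King (W (base (Sum.inl k)) x)),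
      V (Sum.inl k) x = Sum.inr (Sum.inl ⟨(k, x), h⟩) := fun k x h => by
    simp only [V, h, dif_neg, not_false_eq_true]
  have V_refl : ∀ c x, ¬ King (W (base (Sum.inr c)) x) →
      W (base (Sum.inr c)) x = base (Sum.inr c) → V (Sum.inr c) x = Sum.inr c :=
    fun c x h h' => (dif_neg h).trans (if_pos h')
  have V_layer : ∀ c x (h : ¬ King (W (base (Sum.inr c)) x)),
      W (base (Sum.inr c)) x ≠ base (Sum.inr c) → V (Sum.inr c) x =
        Sum.inr (Sum.inr (⟨⟨tp (W (base (Sum.inr c)) x), _, rfl⟩, mkT h⟩, some x, layer c + 1)) :=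
    fun c x h h' => by simp only [V, h, dif_neg, not_false_eq_true, if_neg h']
  have tpV : ∀ e x, tp (base (V e x)) = tp (W (base e) x) := by
    intro e x
    by_cases h : King (W (base e) x)
    · rw [V_king e x h]; rfl
    · rcases e with k | c
      · rw [V_court k x h]; rfl
      · by_cases h' : W (base (Sum.inr c)) x = base (Sum.inr c)
        · rw [V_refl c x h h', h']
        · rw [V_layer c x h h']; exact tp_rep _
  -- the pair `(e, f)` may imitate the pair `s`
  let Good : E → E → Δ × Δ → Prop := fun e f s => tp s.1 = tp (base e) ∧ tp s.2 = tp (base f) ∧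
    (s.1 = s.2 ↔ e = f) ∧ (∀ x, V e x = f → s.2 = W s.1 x) ∧ (∀ x, V f x = e → s.1 = W s.2 x)
  have good_swap : ∀ e f s, Good e f s → Good f e s.swap := by
    rintro e f s ⟨h1, h2, h3, h4, h5⟩
    exact ⟨h2, h1, by rw [eq_comm (a := f), ← h3, eq_comm]; rfl, h5, h4⟩
  have V_self : ∀ e x, V e x = e → base e = W (base e) x := by
    intro e x h
    by_cases hk : King (W (base e) x)
    · rw [V_king e x hk] at h
      exact (congrArg base h).symm
    · rcases e with k | c
      · rw [V_court k x hk] at h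
        cases h
      · by_contra hne
        rw [V_layer c x hk (Ne.symm hne)] at h
        have h' := Sum.inr.inj h
        have : layer c + 1 = layer c := by nth_rw 2 [← h']; rfl
        simp at this
  -- if `f` serves as a witness of `e`, then the pair imitates `base e` and its witness in `Δ`
  have good_V : ∀ e x, e ≠ V e x → Good e (V e x) (base e, W (base e) x) := by
    intro e x hne
    refine ⟨rfl, (tpV e x).symm, ⟨fun h => ?_, fun h => absurd h hne⟩, ?_, ?_⟩
    · exfalso
      apply hne
      dsimp only at h
      by_cases hk : King (W (base e) x)
      · obtain ⟨k, rfl⟩ := king_base e (h ▸ hk)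
        rw [V_king _ x hk]
        exact congrArg Sum.inl (Subtype.ext h)
      · rcases e with k | c
        · exact absurd (h ▸ k.2 : King (W (base (Sum.inl k)) x)) hk
        · rw [V_refl c x hk h.symm]
    · intro y hy
      dsimp only
      by_cases hk : King (W (base e) x)
      · have hk' : King (W (base e) y) := king_congr (by rw [← tpV e x, ← tpV e y, hy]) hk
        rw [V_king e x hk, V_king e y hk'] at hy
        exact (congrArg base hy).symm
      · have hk' : ¬ King (W (base e) y) := fun h =>
          hk (king_congr (by rw [← tpV e x, ← tpV e y, hy]) h)
        rcases e with k | c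
        · rw [V_court k x hk, V_court k y hk'] at hy
          have := congrArg (fun z => z.1.2) (Sum.inl.inj (Sum.inr.inj hy))
          dsimp only at this
          rw [this]
        · have h0 : W (base (Sum.inr c)) x ≠ base (Sum.inr c) := fun h0 =>
            hne (V_refl c x hk h0).symm
          have h1 : W (base (Sum.inr c)) y ≠ base (Sum.inr c) := fun h1 =>
            hne (by rw [← hy, V_refl c y hk' h1])
          rw [V_layer c x hk h0, V_layer c y hk' h1] at hy
          have := congrArg (fun z => z.2.1) (Sum.inr.inj (Sum.inr.inj hy))
          simp only [Option.some.injEq] at this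
          rw [this]
    · intro y hy
      dsimp only
      by_cases hk' : King (W (base (V e x)) y)
      · -- `e` is a king, so that `V e x` is a king or in the court of `e`
        rw [V_king _ y hk'] at hy
        have he : base e = W (base (V e x)) y := (congrArg base hy).symm
        obtain ⟨k, rfl⟩ : ∃ k, e = Sum.inl k := ⟨_, hy.symm⟩
        have hb : base (V (Sum.inl k) x) = W (base (Sum.inl k)) x := by
          by_cases hk : King (W (base (Sum.inl k)) x)
          · rw [V_king _ x hk]; rfl
          · rw [V_court k x hk]; rfl
        rwa [← hb]
      · by_cases hk : King (W (base e) x)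
        · have hv := V_king e x hk
          have hb : base (V e x) = W (base e) x := by rw [hv]; rfl
          rw [← hb]
          rw [hv] at hy hk' ⊢
          rw [V_court _ y hk'] at hy
          exact (congrArg base hy).symm
        · -- otherwise `e` is a witness from the layer after that of `V e x`, which is impossible
          exfalso
          obtain ⟨c, hc⟩ : ∃ c, V e x = Sum.inr c := by
            rcases e with k | c
            · exact ⟨_, V_court k x hk⟩
            · by_cases h0 : W (base (Sum.inr c)) x = base (Sum.inr c)
              · exact ⟨_, V_refl c x hk h0⟩
              · exact ⟨_, V_layer c x hk h0⟩
          have hy0 := hy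
          rw [hc] at hy hk'
          have h1 : W (base (Sum.inr c)) y ≠ base (Sum.inr c) := fun h1 => by
            rw [V_refl c y hk' h1, ← hc] at hy
            exact hne hy.symm
          rw [V_layer c y hk' h1] at hy
          subst hy
          have h0 := fun h0 => hne (V_refl _ x hk h0).symm
          rw [V_layer _ x hk h0] at hc
          have hc' := Sum.inr.inj hc
          have : layer c = layer c + 1 + 1 := by nth_rw 1 [← hc']; rfl
          revert this
          generalize layer c = i
          revert i
          decide
  have good_ex : ∀ e f, ∃ s, Good e f s := by
    intro e f
    by_cases hef : e = f
    · subst hef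
      exact ⟨(base e, base e), rfl, rfl, by simp, V_self e, V_self e⟩
    by_cases h1 : ∃ x, V e x = f
    · obtain ⟨x, rfl⟩ := h1
      exact ⟨_, good_V e x hef⟩
    by_cases h2 : ∃ x, V f x = e
    · obtain ⟨x, rfl⟩ := h2
      exact ⟨_, good_swap _ _ _ (good_V f x (Ne.symm hef))⟩
    push Not at h1 h2
    -- an unconstrained pair imitates any two distinct elements of the right types
    obtain ⟨a, ha, hab⟩ : ∃ a, tp a = tp (base e) ∧ a ≠ base f := by
      by_cases hb : base e = base f
      · have : ¬ King (base e) := fun hk => by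
          obtain ⟨k, rfl⟩ := king_base e hk
          obtain ⟨l, rfl⟩ := king_base f (hb ▸ hk)
          exact hef (congrArg Sum.inl (Subtype.ext hb))
        simp only [King, not_forall] at this
        obtain ⟨a, ha, hne⟩ := this
        exact ⟨a, ha, hb ▸ hne⟩
      · exact ⟨_, rfl, hb⟩
    exact ⟨(a, base f), ha, rfl, by simp [hab, hef], fun x h => absurd h (h1 x),
      fun x h => absurd h (h2 x)⟩
  have hE : Finite E := by infer_instance
  choose s hs using good_ex
  let i := Finite.equivFin E
  let p : E → E → Δ := fun e f => if i e ≤ i f then (s e f).1 else (s f e).2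
  have hp : ∀ e f, Good e f (p e f, p f e) := by
    intro e f
    rcases lt_trichotomy (i e) (i f) with h | h | h
    · simp only [p, h.le, not_le.2 h, if_true, if_false]
      exact hs e f
    · obtain rfl := i.injective h
      have := hs e e
      have h3 := this.2.2.1.2 rfl
      have h4 : ((s e e).1, (s e e).1) = s e e := Prod.ext rfl h3
      simp only [p, le_refl, if_true]
      rw [h4]
      exact this
    · simp only [p, h.le, not_le.2 h, if_true, if_false]
      exact good_swap _ _ _ (hs f e)
  refine ⟨E, hE, p, fun e f g => (hp e f).1.trans (hp e g).1.symm, fun e f => (hp e f).2.2.1,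
    fun e x => ⟨V e x, (hp e (V e x)).2.2.2.1 x rfl⟩, fun a => ?_⟩
  by_cases ha : King a
  · exact ⟨Sum.inl ⟨a, ha⟩, (hp _ _).1⟩
  · exact ⟨Sum.inr (Sum.inr (⟨⟨tp a, a, rfl⟩, mkT ha⟩, none, 0)), (hp _ _).1.trans (tp_rep _)⟩

end Pairing

section

variable {O O' A Q : Type*}

/-! ### Renaming of individuals -/

/-- Rename the individuals of a concept. -/
def Concept.map (f : O → O') : Concept O A Q → Concept O' A Q
  | .sym p => .sym p
  | .sing a => .sing (f a)
  | .neg C => .neg (C.map f)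
  | .union C D => .union (C.map f) (D.map f)
  | .ex R C => .ex R (C.map f)

/-- Rename the individuals of a labelled concept. -/
def Labelled.map (f : O → O') (E : Labelled O A Q) : Labelled O' A Q :=
  f E.ind ⦂ E.con.map f

namespace Concept

variable {f : O → O'} {C : Concept O A Q}

theorem map_eq_sym {p : A} : C.map f = .sym p ↔ C = .sym p := by
  cases C <;> simp [map]

theorem map_eq_sing {a : O'} : C.map f = .sing a ↔ ∃ b, C = .sing b ∧ f b = a := by
  cases C <;> simp [map]

theorem map_eq_neg {D : Concept O' A Q} : C.map f = .neg D ↔ ∃ C', C = .neg C' ∧ C'.map f = D := by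
  cases C <;> simp [map]

theorem map_eq_union {D E : Concept O' A Q} :
    C.map f = .union D E ↔ ∃ C₁ C₂, C = .union C₁ C₂ ∧ C₁.map f = D ∧ C₂.map f = E := by
  cases C <;> simp [map]

theorem map_eq_ex {R : Role Q} {D : Concept O' A Q} :
    C.map f = .ex R D ↔ ∃ C', C = .ex R C' ∧ C'.map f = D := by
  cases C <;> simp [map, and_assoc]

theorem isSingleton_map : (C.map f).IsSingleton ↔ C.IsSingleton := by
  cases C <;> simp [map, IsSingleton]

theorem map_congr {g : O → O'} (h : ∀ a, C.Occurs a → f a = g a) : C.map f = C.map g := by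
  induction C with
  | sym p => rfl
  | sing a => exact congrArg sing (h a rfl)
  | neg C ih => exact congrArg neg (ih h)
  | union C D ihC ihD =>
    exact congrArg₂ union (ihC fun a ha => h a (Or.inl ha)) (ihD fun a ha => h a (Or.inr ha))
  | ex R C ih => exact congrArg (ex R) (ih h)

end Concept

theorem Labelled.map_congr {f g : O → O'} {E : Labelled O A Q} (h : f E.ind = g E.ind)
    (h' : ∀ a, E.con.Occurs a → f a = g a) : E.map f = E.map g := by
  rw [Labelled.map, Labelled.map, h, Concept.map_congr h']

/-- Rename the individuals of a rule instance. -/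
def RuleInst.map (f : O → O') : RuleInst O A Q → RuleInst O' A Q
  | clash a C => clash (f a) (C.map f)
  | notNot a C => notNot (f a) (C.map f)
  | notOr a C D => notOr (f a) (C.map f) (D.map f)
  | or a C D => or (f a) (C.map f) (D.map f)
  | ex a R C => ex (f a) R (C.map f)
  | notEx a R C a' => notEx (f a) R (C.map f) (f a')
  | sym a a' => sym (f a) (f a')
  | notSym a a' => notSym (f a) (f a')
  | mon a a' C => mon (f a) (f a') (C.map f)
  | refl a C => refl (f a) (C.map f)
  | exOr a R S a' => exOr (f a) R S (f a')
  | notExOr a R S C => notExOr (f a) R S (C.map f)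
  | exInv a R a' => exInv (f a) R (f a')
  | notExInv a R C a' => notExInv (f a) R (C.map f) (f a')
  | exNot a R a' => exNot (f a) R (f a')
  | notExNot a R C a' => notExNot (f a) R (C.map f) (f a')
  | exId a a' => exId (f a) (f a')
  | notExId a C => notExId (f a) (C.map f)
  | ub a a' => ub (f a) (f a')

theorem RuleInst.premises_map (f : O → O') (r : RuleInst O A Q) :
    (r.map f).premises = Labelled.map f '' r.premises := by
  cases r <;> simp [map, premises, Labelled.map, Concept.map, Set.image_pair]

theorem RuleInst.conclusions_map (f : O → O') (r : RuleInst O A Q) (w : O) :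
    (r.map f).conclusions (f w) = (r.conclusions w).map (Set.image (Labelled.map f)) := by
  cases r <;> simp [map, conclusions, Labelled.map, Concept.map, Set.image_pair]

/-- Only the rule `ex` makes use of the new individual. -/
theorem RuleInst.conclusions_congr {r : RuleInst O A Q} (h : ¬ r.IsEx) (w w' : O) :
    r.conclusions w = r.conclusions w' := by
  cases r <;> first | rfl | exact absurd trivial h

theorem RuleInst.isEx_map {f : O → O'} {r : RuleInst O A Q} : (r.map f).IsEx ↔ r.IsEx := by
  cases r <;> rfl

/-! ### Hintikka sets -/

/-- A set of labelled concepts is a Hintikka set if it contains, with the premises of any rule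
instance, one of the alternative sets of conclusions. In particular, the closure rule is not
applicable. -/
def Hintikka (H : Set (Labelled O A Q)) : Prop :=
  ∀ r : RuleInst O A Q, r.Applicable H → ∃ w, ∃ X ∈ r.conclusions w, X ⊆ H

/-- If a set is saturated for all rules but the closure rule, then clashes need only be excluded
for concept symbols and singletons. -/
theorem hintikka_of_saturated {H : Set (Labelled O A Q)}
    (hsat : ∀ r : RuleInst O A Q, ¬ r.IsClosure → r.Applicable H →
      ∃ w, ∃ X ∈ r.conclusions w, X ⊆ H)
    (hsym : ∀ a p, (a ⦂ .sym p) ∈ H → (a ⦂ .neg (.sym p)) ∉ H)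
    (hsing : ∀ a b, (a ⦂ .sing b) ∈ H → (a ⦂ .neg (.sing b)) ∉ H) : Hintikka H := by
  have key : ∀ (C : Concept O A Q) a, (a ⦂ C) ∈ H → (a ⦂ .neg C) ∉ H := by
    intro C
    induction C with
    | sym p => exact fun a => hsym a p
    | sing b => exact fun a => hsing a b
    | neg C ih =>
      intro a h h'
      obtain ⟨w, X, hX, hXH⟩ := hsat (.notNot a C) id
        ⟨by simpa [RuleInst.premises] using h', by simp⟩
      simp only [RuleInst.conclusions, List.mem_singleton] at hX
      subst hX
      exact ih a (by simpa using hXH) h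
    | union C D ihC ihD =>
      intro a h h'
      obtain ⟨w, X, hX, hXH⟩ := hsat (.notOr a C D) id
        ⟨by simpa [RuleInst.premises] using h', by simp⟩
      simp only [RuleInst.conclusions, List.mem_singleton] at hX
      subst hX
      obtain ⟨w, Y, hY, hYH⟩ := hsat (.or a C D) id
        ⟨by simpa [RuleInst.premises] using h, by simp⟩
      simp only [RuleInst.conclusions, List.mem_cons, List.not_mem_nil, or_false] at hY
      rcases hY with rfl | rfl
      · exact ihC a (by simpa using hYH) (hXH (by simp))
      · exact ihD a (by simpa using hYH) (hXH (by simp))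
    | ex R C ih =>
      have key : ∀ a b, (a ⦂ .ex R (.sing b)) ∈ H → (a ⦂ .neg (.ex R C)) ∈ H →
          (b ⦂ .neg C) ∈ H := by
        intro a b h h'
        obtain ⟨w, X, hX, hXH⟩ := hsat (.notEx a R C b) id
          ⟨by simpa [RuleInst.premises, Set.insert_subset_iff] using ⟨h', h⟩, by simp⟩
        simp only [RuleInst.conclusions, List.mem_singleton] at hX
        subst hX
        simpa using hXH
      intro a h h'
      by_cases hC : C.IsSingleton
      · obtain ⟨b, rfl⟩ := hC
        have h1 := key a b h h'
        obtain ⟨w, X, hX, hXH⟩ := hsat (.refl b _) id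
          ⟨by simpa [RuleInst.premises] using h1, by simp⟩
        simp only [RuleInst.conclusions, List.mem_singleton] at hX
        subst hX
        exact ih b (by simpa using hXH) h1
      · obtain ⟨w, X, hX, hXH⟩ := hsat (.ex a R C) id
          ⟨by simpa [RuleInst.premises] using h, by rintro _ _ _ ⟨⟩; exact hC⟩
        simp only [RuleInst.conclusions, List.mem_singleton] at hX
        subst hX
        exact ih w (hXH (by simp)) (key a w (hXH (by simp)) h')
  intro r hr
  by_cases hc : r.IsClosure
  · cases r with
    | clash a C => exact absurd (hr.1 (Or.inr rfl)) (key C a (hr.1 (Or.inl rfl)))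
    | _ => exact hc.elim
  · exact hsat r hc hr

namespace Hintikka

variable {H : Set (Labelled O A Q)} {a b c : O} {C D : Concept O A Q} {R S : Role Q}

theorem exists_conclusion (hH : Hintikka H) {r : RuleInst O A Q} (hr : r.premises ⊆ H)
    (hex : ¬ r.IsEx) (a : O) : ∃ X ∈ r.conclusions a, X ⊆ H := by
  obtain ⟨w, h⟩ := hH r ⟨hr, by rintro _ _ _ rfl; exact absurd trivial hex⟩
  rwa [RuleInst.conclusions_congr hex w a] at h

theorem not_clash (hH : Hintikka H) (h : (a ⦂ C) ∈ H) : (a ⦂ .neg C) ∉ H := fun h' => by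
  simpa [RuleInst.conclusions] using hH.exists_conclusion (r := .clash a C)
    (by simp [RuleInst.premises, Set.insert_subset_iff, h, h']) id a

theorem notNot (hH : Hintikka H) (h : (a ⦂ .neg (.neg C)) ∈ H) : (a ⦂ C) ∈ H := by
  simpa [RuleInst.conclusions] using hH.exists_conclusion (r := .notNot a C)
    (by simpa [RuleInst.premises] using h) id a

theorem notOr (hH : Hintikka H) (h : (a ⦂ .neg (.union C D)) ∈ H) :
    (a ⦂ .neg C) ∈ H ∧ (a ⦂ .neg D) ∈ H := by
  simpa [RuleInst.conclusions, Set.insert_subset_iff] using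
    hH.exists_conclusion (r := .notOr a C D) (by simpa [RuleInst.premises] using h) id a

theorem or (hH : Hintikka H) (h : (a ⦂ .union C D) ∈ H) : (a ⦂ C) ∈ H ∨ (a ⦂ D) ∈ H := by
  simpa [RuleInst.conclusions] using hH.exists_conclusion (r := .or a C D)
    (by simpa [RuleInst.premises] using h) id a

theorem ex (hH : Hintikka H) (h : (a ⦂ .ex R C) ∈ H) (hC : ¬ C.IsSingleton) :
    ∃ w, (a ⦂ .ex R (.sing w)) ∈ H ∧ (w ⦂ C) ∈ H := by
  simpa [RuleInst.conclusions, Set.insert_subset_iff] using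
    hH (.ex a R C) ⟨by simpa [RuleInst.premises] using h, by rintro _ _ _ ⟨⟩; exact hC⟩

theorem notEx (hH : Hintikka H) (h : (a ⦂ .neg (.ex R C)) ∈ H) (h' : (a ⦂ .ex R (.sing b)) ∈ H) :
    (b ⦂ .neg C) ∈ H := by
  simpa [RuleInst.conclusions] using hH.exists_conclusion (r := .notEx a R C b)
    (by simpa [RuleInst.premises, Set.insert_subset_iff] using ⟨h, h'⟩) id a

theorem sym (hH : Hintikka H) (h : (a ⦂ .sing b) ∈ H) : (b ⦂ .sing a) ∈ H := by
  simpa [RuleInst.conclusions] using hH.exists_conclusion (r := .sym a b)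
    (by simpa [RuleInst.premises] using h) id a

theorem notSym (hH : Hintikka H) (h : (a ⦂ .neg (.sing b)) ∈ H) :
    (b ⦂ .neg (.sing a)) ∈ H := by
  simpa [RuleInst.conclusions] using hH.exists_conclusion (r := .notSym a b)
    (by simpa [RuleInst.premises] using h) id a

theorem mon (hH : Hintikka H) (h : (a ⦂ .sing b) ∈ H) (h' : (b ⦂ C) ∈ H) : (a ⦂ C) ∈ H := by
  simpa [RuleInst.conclusions] using hH.exists_conclusion (r := .mon a b C)
    (by simpa [RuleInst.premises, Set.insert_subset_iff] using ⟨h, h'⟩) id a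

theorem refl (hH : Hintikka H) (h : IsLabel a H) : (a ⦂ .sing a) ∈ H := by
  obtain ⟨C, h⟩ := h
  simpa [RuleInst.conclusions] using hH.exists_conclusion (r := .refl a C)
    (by simpa [RuleInst.premises] using h) id a

theorem exOr (hH : Hintikka H) (h : (a ⦂ .ex (.union R S) (.sing b)) ∈ H) :
    (a ⦂ .ex R (.sing b)) ∈ H ∨ (a ⦂ .ex S (.sing b)) ∈ H := by
  simpa [RuleInst.conclusions] using hH.exists_conclusion (r := .exOr a R S b)
    (by simpa [RuleInst.premises] using h) id a

theorem notExOr (hH : Hintikka H) (h : (a ⦂ .neg (.ex (.union R S) C)) ∈ H) :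
    (a ⦂ .neg (.ex R C)) ∈ H ∧ (a ⦂ .neg (.ex S C)) ∈ H := by
  simpa [RuleInst.conclusions, Set.insert_subset_iff] using
    hH.exists_conclusion (r := .notExOr a R S C) (by simpa [RuleInst.premises] using h) id a

theorem exInv (hH : Hintikka H) (h : (a ⦂ .ex (.inv R) (.sing b)) ∈ H) :
    (b ⦂ .ex R (.sing a)) ∈ H := by
  simpa [RuleInst.conclusions] using hH.exists_conclusion (r := .exInv a R b)
    (by simpa [RuleInst.premises] using h) id a

theorem notExInv (hH : Hintikka H) (h : (a ⦂ .neg (.ex (.inv R) C)) ∈ H)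
    (h' : (b ⦂ .ex R (.sing a)) ∈ H) : (b ⦂ .neg C) ∈ H := by
  simpa [RuleInst.conclusions] using hH.exists_conclusion (r := .notExInv a R C b)
    (by simpa [RuleInst.premises, Set.insert_subset_iff] using ⟨h, h'⟩) id a

theorem exNot (hH : Hintikka H) (h : (a ⦂ .ex (.neg R) (.sing b)) ∈ H) :
    (a ⦂ .neg (.ex R (.sing b))) ∈ H := by
  simpa [RuleInst.conclusions] using hH.exists_conclusion (r := .exNot a R b)
    (by simpa [RuleInst.premises] using h) id a

theorem notExNot (hH : Hintikka H) (h : (a ⦂ .neg (.ex (.neg R) C)) ∈ H) (hb : IsLabel b H) :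
    (a ⦂ .ex R (.sing b)) ∈ H ∨ (b ⦂ .neg C) ∈ H := by
  simpa [RuleInst.conclusions] using hH.exists_conclusion (r := .notExNot a R C b)
    (by simpa [RuleInst.premises, Set.insert_subset_iff] using ⟨h, hH.refl hb⟩) id a

theorem exId (hH : Hintikka H) (h : (a ⦂ .ex .id (.sing b)) ∈ H) : (a ⦂ .sing b) ∈ H := by
  simpa [RuleInst.conclusions] using hH.exists_conclusion (r := .exId a b)
    (by simpa [RuleInst.premises] using h) id a

theorem notExId (hH : Hintikka H) (h : (a ⦂ .neg (.ex .id C)) ∈ H) : (a ⦂ .neg C) ∈ H := by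
  simpa [RuleInst.conclusions] using hH.exists_conclusion (r := .notExId a C)
    (by simpa [RuleInst.premises] using h) id a

end Hintikka

end

section

variable {O A Q : Type*}

/-! ### Finite sets closed under subconcepts -/

/-- Closure under subconcepts, where the roles below an existential quantifier may also be
replaced by their subroles. -/
structure SubClosed (Γ : Set (Concept O A Q)) : Prop where
  of_neg : ∀ {C}, Concept.neg C ∈ Γ → C ∈ Γ
  of_union : ∀ {C D}, Concept.union C D ∈ Γ → C ∈ Γ ∧ D ∈ Γ
  of_ex : ∀ {R C}, Concept.ex R C ∈ Γ → C ∈ Γ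
  of_exUnion : ∀ {R S C}, Concept.ex (.union R S) C ∈ Γ →
    Concept.ex R C ∈ Γ ∧ Concept.ex S C ∈ Γ
  of_exInv : ∀ {R C}, Concept.ex (.inv R) C ∈ Γ → Concept.ex R C ∈ Γ
  of_exNeg : ∀ {R C}, Concept.ex (.neg R) C ∈ Γ → Concept.ex R C ∈ Γ

/-- The subroles of a role. -/
def Role.subs : Role Q → Set (Role Q)
  | .sym q => {.sym q}
  | .union R S => {.union R S} ∪ (R.subs ∪ S.subs)
  | .inv R => {.inv R} ∪ R.subs
  | .neg R => {.neg R} ∪ R.subs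
  | .id => {.id}

theorem Role.self_mem_subs (R : Role Q) : R ∈ R.subs := by
  cases R <;> simp [subs]

theorem Role.finite_subs (R : Role Q) : R.subs.Finite := by
  induction R with
  | sym q => exact Set.finite_singleton _
  | union R S hR hS => exact (Set.finite_singleton _).union (hR.union hS)
  | inv R hR => exact (Set.finite_singleton _).union hR
  | neg R hR => exact (Set.finite_singleton _).union hR
  | id => exact Set.finite_singleton _

/-- Closure of a set of roles under subroles. -/
structure RoleClosed (ρ : Set (Role Q)) : Prop where
  of_union : ∀ {R S}, Role.union R S ∈ ρ → R ∈ ρ ∧ S ∈ ρ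
  of_inv : ∀ {R}, Role.inv R ∈ ρ → R ∈ ρ
  of_neg : ∀ {R}, Role.neg R ∈ ρ → R ∈ ρ

theorem Role.roleClosed_subs (R : Role Q) : RoleClosed R.subs := by
  induction R with
  | sym q => constructor <;> simp [subs]
  | id => constructor <;> simp [subs]
  | union R S hR hS =>
    constructor <;> simp only [subs, Set.mem_union, Set.mem_singleton_iff, Role.union.injEq,
      reduceCtorEq, false_or]
    · rintro R' S' (⟨rfl, rfl⟩ | h | h)
      · simp [self_mem_subs]
      · simp [hR.of_union h]
      · simp [hS.of_union h]
    · rintro R' (h | h)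
      · simp [hR.of_inv h]
      · simp [hS.of_inv h]
    · rintro R' (h | h)
      · simp [hR.of_neg h]
      · simp [hS.of_neg h]
  | inv R hR =>
    constructor <;> simp only [subs, Set.mem_union, Set.mem_singleton_iff, Role.inv.injEq,
      reduceCtorEq, false_or]
    · exact fun h => by simp [hR.of_union h]
    · rintro R' (rfl | h)
      · simp [self_mem_subs]
      · simp [hR.of_inv h]
    · exact fun h => by simp [hR.of_neg h]
  | neg R hR =>
    constructor <;> simp only [subs, Set.mem_union, Set.mem_singleton_iff, Role.neg.injEq,
      reduceCtorEq, false_or]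
    · exact fun h => by simp [hR.of_union h]
    · exact fun h => by simp [hR.of_inv h]
    · rintro R' (rfl | h)
      · simp [self_mem_subs]
      · simp [hR.of_neg h]

/-- The subconcepts of a concept, with the roles below an existential quantifier replaced by any
of their subroles. -/
def Concept.subs : Concept O A Q → Set (Concept O A Q)
  | .sym p => {.sym p}
  | .sing a => {.sing a}
  | .neg C => {.neg C} ∪ C.subs
  | .union C D => {.union C D} ∪ (C.subs ∪ D.subs)
  | .ex R C => (fun S => .ex S C) '' R.subs ∪ C.subs

theorem Concept.self_mem_subs (C : Concept O A Q) : C ∈ C.subs := by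
  cases C <;> simp [subs, Role.self_mem_subs]

theorem Concept.finite_subs (C : Concept O A Q) : C.subs.Finite := by
  induction C with
  | sym p => exact Set.finite_singleton _
  | sing a => exact Set.finite_singleton _
  | neg C hC => exact (Set.finite_singleton _).union hC
  | union C D hC hD => exact (Set.finite_singleton _).union (hC.union hD)
  | ex R C hC => exact (R.finite_subs.image _).union hC

theorem Concept.subClosed_subs (C : Concept O A Q) : SubClosed C.subs := by
  induction C with
  | sym p => constructor <;> simp [subs]
  | sing a => constructor <;> simp [subs]
  | neg C hC =>
    have := C.self_mem_subs
    obtain ⟨h1, h2, h3, h4, h5, h6⟩ := hC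
    constructor <;> simp only [subs, Set.mem_union, Set.mem_singleton_iff, reduceCtorEq,
      Concept.neg.injEq, false_or] <;> grind
  | union C D hC hD =>
    have := C.self_mem_subs
    have := D.self_mem_subs
    obtain ⟨h1, h2, h3, h4, h5, h6⟩ := hC
    obtain ⟨k1, k2, k3, k4, k5, k6⟩ := hD
    constructor <;> simp only [subs, Set.mem_union, Set.mem_singleton_iff, reduceCtorEq,
      Concept.union.injEq, false_or] <;> grind
  | ex R C hC =>
    have := C.self_mem_subs
    obtain ⟨h1, h2, h3, h4, h5, h6⟩ := hC
    obtain ⟨k1, k2, k3⟩ := R.roleClosed_subs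
    constructor <;> simp only [subs, Set.mem_union, Set.mem_image, reduceCtorEq,
      Concept.ex.injEq, and_false, exists_false, false_or] <;> grind

theorem SubClosed.biUnion {ι : Type*} {I : Set ι} {Γ : ι → Set (Concept O A Q)}
    (h : ∀ i ∈ I, SubClosed (Γ i)) : SubClosed (⋃ i ∈ I, Γ i) := by
  constructor <;> simp only [Set.mem_iUnion, exists_prop]
  · rintro C ⟨i, hi, hC⟩; exact ⟨i, hi, (h i hi).of_neg hC⟩
  · rintro C D ⟨i, hi, hC⟩
    exact ⟨⟨i, hi, ((h i hi).of_union hC).1⟩, ⟨i, hi, ((h i hi).of_union hC).2⟩⟩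
  · rintro R C ⟨i, hi, hC⟩; exact ⟨i, hi, (h i hi).of_ex hC⟩
  · rintro R S C ⟨i, hi, hC⟩
    exact ⟨⟨i, hi, ((h i hi).of_exUnion hC).1⟩, ⟨i, hi, ((h i hi).of_exUnion hC).2⟩⟩
  · rintro R C ⟨i, hi, hC⟩; exact ⟨i, hi, (h i hi).of_exInv hC⟩
  · rintro R C ⟨i, hi, hC⟩; exact ⟨i, hi, (h i hi).of_exNeg hC⟩

theorem exists_finite_subClosed {S : Set (Concept O A Q)} (hS : S.Finite) :
    ∃ Γ : Set (Concept O A Q), Γ.Finite ∧ SubClosed Γ ∧ S ⊆ Γ :=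
  ⟨⋃ C ∈ S, C.subs, hS.biUnion fun C _ => C.finite_subs,
    SubClosed.biUnion fun C _ => C.subClosed_subs,
    fun C hC => Set.mem_biUnion hC C.self_mem_subs⟩

/-- A set of concepts together with the negations of its elements. -/
def signed (Γ : Set (Concept O A Q)) : Set (Concept O A Q) := Γ ∪ Concept.neg '' Γ

section Signed

variable {Γ : Set (Concept O A Q)}

theorem mem_signed {C : Concept O A Q} (h : C ∈ Γ) : C ∈ signed Γ := Or.inl h

theorem neg_mem_signed {C : Concept O A Q} (h : C ∈ Γ) : .neg C ∈ signed Γ :=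
  Or.inr ⟨C, h, rfl⟩

theorem SubClosed.of_neg_mem_signed (hΓ : SubClosed Γ) {C : Concept O A Q}
    (h : .neg C ∈ signed Γ) : C ∈ Γ := by
  rcases h with h | ⟨D, hD, h⟩
  · exact hΓ.of_neg h
  · cases h; exact hD

theorem union_mem_signed {C D : Concept O A Q} : .union C D ∈ signed Γ ↔ .union C D ∈ Γ := by
  simp [signed]

theorem ex_mem_signed {R : Role Q} {C : Concept O A Q} : .ex R C ∈ signed Γ ↔ .ex R C ∈ Γ := by
  simp [signed]

theorem sing_mem_signed {a : O} : Concept.sing (A := A) (Q := Q) a ∈ signed Γ ↔ .sing a ∈ Γ := by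
  simp [signed]

end Signed

end

section

variable {O A Q E : Type*}

/-! ### Folding a Hintikka set -/

/-- The data for folding the Hintikka set `H` to a set with labels `E`: a pair `(e, f)` of
elements of `E` imitates the pair of labels `(P e f, P f e)` of `H`, individuals `a` and `b` with
`a : {b}` in `H` being regarded as equal. The map `σ` interprets the individuals; those which are
not labels in `H` are kept as they are, on the right-hand side of `E ⊕ O`. -/
structure Folding (H : Set (Labelled O A Q)) (Γ : Set (Concept O A Q)) (P : E → E → O)
    (σ : O → E ⊕ O) : Prop where
  isLabel : ∀ e f, IsLabel (P e f) H
  /-- The concepts from `signed Γ` at the label imitated by `e` do not depend on the pair. -/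
  type_eq : ∀ e f g C, C ∈ signed Γ → (P e f ⦂ C) ∈ H → (P e g ⦂ C) ∈ H
  /-- Equality of labels is imitated faithfully. -/
  eq_iff : ∀ e f, (P e f ⦂ .sing (P f e)) ∈ H ↔ e = f
  /-- If the rule `ex` is applicable at `e`, then its conclusions hold for some pair `(e, f)`. -/
  witness : ∀ e R C, .ex R C ∈ Γ → ¬ C.IsSingleton → (P e e ⦂ .ex R C) ∈ H →
    ∃ f b, (P e f ⦂ .ex R (.sing b)) ∈ H ∧ (b ⦂ .sing (P f e)) ∈ H ∧ (P f e ⦂ C) ∈ H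
  map_of_not_isLabel : ∀ b, ¬ IsLabel b H → σ b = .inr b
  /-- A label `b` of `H` named in `Γ` is sent to an element imitating only individuals equal
  to `b`. -/
  map_of_isLabel : ∀ b, .sing b ∈ Γ → IsLabel b H → ∃ e, σ b = .inl e ∧ ∀ f, (P e f ⦂ .sing b) ∈ H

/-- The concepts at `e` in the folded set: those from `signed Γ` at the labels imitated by `e`,
and those concerning a pair `(e, f)`, according to the imitated pair. -/
inductive Folded (H : Set (Labelled O A Q)) (Γ : Set (Concept O A Q)) (P : E → E → O)
    (σ : O → E ⊕ O) : E → Concept (E ⊕ O) A Q → Prop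
  | base {e C D} : C ∈ signed Γ → (∀ f, (P e f ⦂ C) ∈ H) → D = C.map σ → Folded H Γ P σ e D
  | ex {e f R b} : (P e f ⦂ .ex R (.sing b)) ∈ H → (b ⦂ .sing (P f e)) ∈ H →
      Folded H Γ P σ e (.ex R (.sing (.inl f)))
  | negEx {e f R b} : (P e f ⦂ .neg (.ex R (.sing b))) ∈ H → (b ⦂ .sing (P f e)) ∈ H →
      Folded H Γ P σ e (.neg (.ex R (.sing (.inl f))))
  | sing {e} : Folded H Γ P σ e (.sing (.inl e))
  | negSing {e f} : e ≠ f → Folded H Γ P σ e (.neg (.sing (.inl f)))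

/-- The folded set. All its labels come from `E`. -/
def foldedSet (H : Set (Labelled O A Q)) (Γ : Set (Concept O A Q)) (P : E → E → O)
    (σ : O → E ⊕ O) : Set (Labelled (E ⊕ O) A Q) :=
  {L | ∃ e, L.ind = .inl e ∧ Folded H Γ P σ e L.con}

namespace Folding

variable {H : Set (Labelled O A Q)} {Γ : Set (Concept O A Q)} {P : E → E → O} {σ : O → E ⊕ O}

theorem mem_foldedSet {z : E ⊕ O} {D : Concept (E ⊕ O) A Q} :
    (z ⦂ D) ∈ foldedSet H Γ P σ ↔ ∃ e, z = .inl e ∧ Folded H Γ P σ e D := Iff.rfl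

theorem inl_mem {e : E} {D : Concept (E ⊕ O) A Q} :
    (.inl e ⦂ D) ∈ foldedSet H Γ P σ ↔ Folded H Γ P σ e D := by
  simp [mem_foldedSet]

theorem folded_of_mem (F : Folding H Γ P σ) {e f : E} {C : Concept O A Q} (hC : C ∈ signed Γ) (h : (P e f ⦂ C) ∈ H) :
    Folded H Γ P σ e (C.map σ) :=
  .base hC (fun g => F.type_eq e f g C hC h) rfl

theorem of_sing (F : Folding H Γ P σ) (hH : Hintikka H) {e : E} {z : E ⊕ O}
    (h : Folded H Γ P σ e (.sing z)) : z = .inl e := by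
  cases h with
  | sing => rfl
  | base hC h hD =>
    obtain ⟨b, rfl, rfl⟩ := Concept.map_eq_sing.1 hD.symm
    obtain ⟨f, hf, hb⟩ := F.map_of_isLabel b (sing_mem_signed.1 hC) ⟨_, hH.sym (h e)⟩
    rw [hf, (F.eq_iff e f).1 (hH.mon (h f) (hH.sym (hb e)))]

theorem of_negSing (F : Folding H Γ P σ) (hH : Hintikka H) (hΓ : SubClosed Γ) {e : E}
    {z : E ⊕ O} (h : Folded H Γ P σ e (.neg (.sing z))) :
    ∃ f, z = .inl f ∧ e ≠ f := by
  cases h with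
  | negSing h => exact ⟨_, rfl, h⟩
  | base hC h hD =>
    obtain ⟨C', rfl, hC'⟩ := Concept.map_eq_neg.1 hD.symm
    obtain ⟨b, rfl, rfl⟩ := Concept.map_eq_sing.1 hC'
    obtain ⟨f, hf, hb⟩ := F.map_of_isLabel b (hΓ.of_neg_mem_signed hC) ⟨_, hH.notSym (h e)⟩
    refine ⟨f, hf, ?_⟩
    rintro rfl
    exact hH.not_clash (hb e) (h e)

theorem of_ex_inl (F : Folding H Γ P σ) (hH : Hintikka H) (hΓ : SubClosed Γ) {e f : E}
    {R : Role Q} (h : Folded H Γ P σ e (.ex R (.sing (.inl f)))) :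
    ∃ b, (P e f ⦂ .ex R (.sing b)) ∈ H ∧ (b ⦂ .sing (P f e)) ∈ H := by
  cases h with
  | ex h h' => exact ⟨_, h, h'⟩
  | base hC h hD =>
    obtain ⟨C', rfl, hC'⟩ := Concept.map_eq_ex.1 hD.symm
    obtain ⟨b, rfl, hb⟩ := Concept.map_eq_sing.1 hC'
    by_cases hl : IsLabel b H
    · obtain ⟨g, hg, hgb⟩ := F.map_of_isLabel b (hΓ.of_ex (ex_mem_signed.1 hC)) hl
      obtain rfl := Sum.inl.inj (hg.symm.trans hb)
      exact ⟨b, h g, hH.sym (hgb e)⟩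
    · rw [F.map_of_not_isLabel b hl] at hb
      cases hb

theorem of_ex_inr (F : Folding H Γ P σ) (hΓ : SubClosed Γ) {e : E} {b : O} {R : Role Q}
    (h : Folded H Γ P σ e (.ex R (.sing (.inr b)))) :
    ¬ IsLabel b H ∧ .ex R (.sing b) ∈ Γ ∧ ∀ f, (P e f ⦂ .ex R (.sing b)) ∈ H := by
  cases h with
  | base hC h hD =>
    obtain ⟨C', rfl, hC'⟩ := Concept.map_eq_ex.1 hD.symm
    obtain ⟨c, rfl, hc⟩ := Concept.map_eq_sing.1 hC'
    by_cases hl : IsLabel c H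
    · obtain ⟨g, hg, -⟩ := F.map_of_isLabel c (hΓ.of_ex (ex_mem_signed.1 hC)) hl
      rw [hg] at hc
      cases hc
    · rw [F.map_of_not_isLabel c hl] at hc
      cases hc
      exact ⟨hl, ex_mem_signed.1 hC, h⟩

theorem of_negEx (hΓ : SubClosed Γ) {e : E} {R : Role Q} {D : Concept (E ⊕ O) A Q}
    (h : Folded H Γ P σ e (.neg (.ex R D))) :
    (∃ C, .ex R C ∈ Γ ∧ (∀ f, (P e f ⦂ .neg (.ex R C)) ∈ H) ∧ C.map σ = D) ∨
      ∃ f b, (P e f ⦂ .neg (.ex R (.sing b))) ∈ H ∧ (b ⦂ .sing (P f e)) ∈ H ∧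
        D = .sing (.inl f) := by
  cases h with
  | base hC h hD =>
    obtain ⟨C', rfl, hC'⟩ := Concept.map_eq_neg.1 hD.symm
    obtain ⟨C, rfl, rfl⟩ := Concept.map_eq_ex.1 hC'
    exact Or.inl ⟨C, hΓ.of_neg_mem_signed hC, h, rfl⟩
  | negEx h h' => exact Or.inr ⟨_, _, h, h', rfl⟩

/-- If `Γ` is closed under subconcepts, then the folded set is again a Hintikka set. -/
theorem hintikka_foldedSet (F : Folding H Γ P σ) (hH : Hintikka H) (hΓ : SubClosed Γ) :
    Hintikka (foldedSet H Γ P σ) := by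
  refine hintikka_of_saturated (fun r hc ⟨hp, hex⟩ => ?_) ?_ ?_
  · cases r with
    | clash a C => exact absurd trivial hc
    | notNot a C =>
      simp only [RuleInst.premises, Set.singleton_subset_iff, mem_foldedSet] at hp
      obtain ⟨e, rfl, h⟩ := hp
      refine ⟨.inl e, ?_⟩
      simp only [RuleInst.conclusions, List.mem_singleton, exists_eq_left,
        Set.singleton_subset_iff, inl_mem]
      cases h with
      | base hC h hD =>
        obtain ⟨C', rfl, hC'⟩ := Concept.map_eq_neg.1 hD.symm
        obtain ⟨C, rfl, rfl⟩ := Concept.map_eq_neg.1 hC'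
        exact F.folded_of_mem (mem_signed (hΓ.of_neg (hΓ.of_neg_mem_signed hC)))
          (hH.notNot (h e))
    | notOr a C D =>
      simp only [RuleInst.premises, Set.singleton_subset_iff, mem_foldedSet] at hp
      obtain ⟨e, rfl, h⟩ := hp
      refine ⟨.inl e, ?_⟩
      simp only [RuleInst.conclusions, List.mem_singleton, exists_eq_left,
        Set.insert_subset_iff, Set.singleton_subset_iff, inl_mem]
      cases h with
      | base hC h hD =>
        obtain ⟨C', rfl, hC'⟩ := Concept.map_eq_neg.1 hD.symm
        obtain ⟨C, D, rfl, rfl, rfl⟩ := Concept.map_eq_union.1 hC'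
        have hCD := hΓ.of_union (hΓ.of_neg_mem_signed hC)
        exact ⟨F.folded_of_mem (neg_mem_signed hCD.1) (hH.notOr (h e)).1,
          F.folded_of_mem (neg_mem_signed hCD.2) (hH.notOr (h e)).2⟩
    | or a C D =>
      simp only [RuleInst.premises, Set.singleton_subset_iff, mem_foldedSet] at hp
      obtain ⟨e, rfl, h⟩ := hp
      refine ⟨.inl e, ?_⟩
      simp only [RuleInst.conclusions, List.mem_cons, List.not_mem_nil, or_false,
        exists_eq_or_imp, exists_eq_left, Set.singleton_subset_iff, inl_mem]
      cases h with
      | base hC h hD =>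
        obtain ⟨C, D, rfl, rfl, rfl⟩ := Concept.map_eq_union.1 hD.symm
        have hCD := hΓ.of_union (union_mem_signed.1 hC)
        exact (hH.or (h e)).imp (F.folded_of_mem (mem_signed hCD.1))
          (F.folded_of_mem (mem_signed hCD.2))
    | ex a R C =>
      replace hex := hex a R C rfl
      simp only [RuleInst.premises, Set.singleton_subset_iff, mem_foldedSet] at hp
      obtain ⟨e, rfl, h⟩ := hp
      cases h with
      | ex => exact absurd ⟨_, rfl⟩ hex
      | base hC h hD =>
        obtain ⟨C, rfl, rfl⟩ := Concept.map_eq_ex.1 hD.symm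
        rw [ex_mem_signed] at hC
        rw [Concept.isSingleton_map] at hex
        obtain ⟨f, b, h1, h2, h3⟩ := F.witness e R C hC hex (h e)
        refine ⟨.inl f, ?_⟩
        simp only [RuleInst.conclusions, List.mem_singleton, exists_eq_left,
          Set.insert_subset_iff, Set.singleton_subset_iff, inl_mem]
        exact ⟨.ex h1 h2, F.folded_of_mem (mem_signed (hΓ.of_ex hC)) h3⟩
    | notEx a R D z =>
      simp only [RuleInst.premises, Set.insert_subset_iff, Set.singleton_subset_iff,
        mem_foldedSet] at hp
      obtain ⟨⟨e, rfl, h⟩, e', he', h'⟩ := hp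
      cases he'
      refine ⟨.inl e, ?_⟩
      simp only [RuleInst.conclusions, List.mem_singleton, exists_eq_left,
        Set.singleton_subset_iff]
      rcases z with f | b
      · rw [inl_mem]
        obtain ⟨b, h1, h2⟩ := F.of_ex_inl hH hΓ h'
        rcases of_negEx hΓ h with ⟨C, hC, h0, rfl⟩ | ⟨g, c, h3, h4, rfl⟩
        · exact F.folded_of_mem (neg_mem_signed (hΓ.of_ex hC))
            (hH.mon (hH.sym h2) (hH.notEx (h0 f) h1))
        · refine .negSing ?_
          rintro rfl
          exact hH.not_clash (hH.mon h2 (hH.sym h4)) (hH.notEx h3 h1)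
      · exfalso
        obtain ⟨hb, hR, h1⟩ := F.of_ex_inr hΓ h'
        rcases of_negEx hΓ h with ⟨C, hC, h0, rfl⟩ | ⟨g, c, h3, h4, rfl⟩
        · exact hb ⟨_, hH.notEx (h0 e) (h1 e)⟩
        · exact hb ⟨_, hH.notEx h3 (h1 g)⟩
    | sym a z =>
      simp only [RuleInst.premises, Set.singleton_subset_iff, mem_foldedSet] at hp
      obtain ⟨e, rfl, h⟩ := hp
      obtain rfl := F.of_sing hH h
      exact ⟨.inl e, by simpa [RuleInst.conclusions, inl_mem] using h⟩
    | notSym a z =>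
      simp only [RuleInst.premises, Set.singleton_subset_iff, mem_foldedSet] at hp
      obtain ⟨e, rfl, h⟩ := hp
      obtain ⟨f, rfl, hef⟩ := F.of_negSing hH hΓ h
      refine ⟨.inl e, ?_⟩
      simp only [RuleInst.conclusions, List.mem_singleton, exists_eq_left,
        Set.singleton_subset_iff, inl_mem]
      exact .negSing hef.symm
    | mon a z C =>
      simp only [RuleInst.premises, Set.insert_subset_iff, Set.singleton_subset_iff] at hp
      obtain ⟨⟨e, he, h⟩, h'⟩ := hp
      dsimp only at he h
      subst he
      obtain rfl := F.of_sing hH h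
      exact ⟨.inl e, by simpa [RuleInst.conclusions] using h'⟩
    | refl a C =>
      simp only [RuleInst.premises, Set.singleton_subset_iff, mem_foldedSet] at hp
      obtain ⟨e, rfl, h⟩ := hp
      refine ⟨.inl e, ?_⟩
      simp only [RuleInst.conclusions, List.mem_singleton, exists_eq_left,
        Set.singleton_subset_iff, inl_mem]
      exact .sing
    | exOr a R S z =>
      simp only [RuleInst.premises, Set.singleton_subset_iff, mem_foldedSet] at hp
      obtain ⟨e, rfl, h⟩ := hp
      refine ⟨.inl e, ?_⟩
      simp only [RuleInst.conclusions, List.mem_cons, List.not_mem_nil, or_false,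
        exists_eq_or_imp, exists_eq_left, Set.singleton_subset_iff, inl_mem]
      rcases z with f | b
      · obtain ⟨b, h1, h2⟩ := F.of_ex_inl hH hΓ h
        exact (hH.exOr h1).imp (fun h => .ex h h2) (fun h => .ex h h2)
      · obtain ⟨hb, hR, h1⟩ := F.of_ex_inr hΓ h
        have hσ := F.map_of_not_isLabel b hb
        rw [← hσ]
        exact (hH.exOr (h1 e)).imp (F.folded_of_mem (mem_signed (hΓ.of_exUnion hR).1))
          (F.folded_of_mem (mem_signed (hΓ.of_exUnion hR).2))
    | notExOr a R S D =>
      simp only [RuleInst.premises, Set.singleton_subset_iff, mem_foldedSet] at hp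
      obtain ⟨e, rfl, h⟩ := hp
      refine ⟨.inl e, ?_⟩
      simp only [RuleInst.conclusions, List.mem_singleton, exists_eq_left,
        Set.insert_subset_iff, Set.singleton_subset_iff, inl_mem]
      rcases of_negEx hΓ h with ⟨C, hC, h0, rfl⟩ | ⟨g, c, h3, h4, rfl⟩
      · have hRS := hΓ.of_exUnion hC
        exact ⟨F.folded_of_mem (neg_mem_signed hRS.1) (hH.notExOr (h0 e)).1,
          F.folded_of_mem (neg_mem_signed hRS.2) (hH.notExOr (h0 e)).2⟩
      · exact ⟨.negEx (hH.notExOr h3).1 h4, .negEx (hH.notExOr h3).2 h4⟩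
    | exInv a R z =>
      simp only [RuleInst.premises, Set.singleton_subset_iff, mem_foldedSet] at hp
      obtain ⟨e, rfl, h⟩ := hp
      refine ⟨.inl e, ?_⟩
      simp only [RuleInst.conclusions, List.mem_singleton, exists_eq_left,
        Set.singleton_subset_iff]
      rcases z with f | b
      · obtain ⟨b, h1, h2⟩ := F.of_ex_inl hH hΓ h
        exact inl_mem.2 (.ex (hH.mon (hH.sym h2) (hH.exInv h1)) (hH.refl (F.isLabel e f)))
      · obtain ⟨hb, hR, h1⟩ := F.of_ex_inr hΓ h
        exact absurd ⟨_, hH.exInv (h1 e)⟩ hb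
    | notExInv a R D z =>
      simp only [RuleInst.premises, Set.insert_subset_iff, Set.singleton_subset_iff,
        mem_foldedSet] at hp
      obtain ⟨⟨e, rfl, h⟩, f, rfl, h'⟩ := hp
      refine ⟨.inl e, ?_⟩
      simp only [RuleInst.conclusions, List.mem_singleton, exists_eq_left,
        Set.singleton_subset_iff, inl_mem]
      obtain ⟨b, h1, h2⟩ := F.of_ex_inl hH hΓ h'
      rcases of_negEx hΓ h with ⟨C, hC, h0, rfl⟩ | ⟨g, c, h3, h4, rfl⟩
      · exact F.folded_of_mem (neg_mem_signed (hΓ.of_ex hC))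
          (hH.notExInv (hH.mon h2 (h0 f)) h1)
      · refine .negSing ?_
        rintro rfl
        exact hH.not_clash (hH.sym h4) (hH.notExInv (hH.mon h2 h3) h1)
    | exNot a R z =>
      simp only [RuleInst.premises, Set.singleton_subset_iff, mem_foldedSet] at hp
      obtain ⟨e, rfl, h⟩ := hp
      refine ⟨.inl e, ?_⟩
      simp only [RuleInst.conclusions, List.mem_singleton, exists_eq_left,
        Set.singleton_subset_iff, inl_mem]
      rcases z with f | b
      · obtain ⟨b, h1, h2⟩ := F.of_ex_inl hH hΓ h
        exact .negEx (hH.exNot h1) h2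
      · obtain ⟨hb, hR, h1⟩ := F.of_ex_inr hΓ h
        have hσ := F.map_of_not_isLabel b hb
        rw [← hσ]
        exact F.folded_of_mem (neg_mem_signed (hΓ.of_exNeg hR)) (hH.exNot (h1 e))
    | notExNot a R D z =>
      simp only [RuleInst.premises, Set.insert_subset_iff, Set.singleton_subset_iff,
        mem_foldedSet] at hp
      obtain ⟨⟨e, rfl, h⟩, f, rfl, -⟩ := hp
      refine ⟨.inl e, ?_⟩
      simp only [RuleInst.conclusions, List.mem_cons, List.not_mem_nil, or_false,
        exists_eq_or_imp, exists_eq_left, Set.singleton_subset_iff, inl_mem]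
      rcases of_negEx hΓ h with ⟨C, hC, h0, rfl⟩ | ⟨g, c, h3, h4, rfl⟩
      · exact (hH.notExNot (h0 f) (F.isLabel f e)).imp
          (fun h => .ex h (hH.refl (F.isLabel f e)))
          (F.folded_of_mem (neg_mem_signed (hΓ.of_ex hC)))
      · by_cases hfg : f = g
        · subst hfg
          refine (hH.notExNot h3 (F.isLabel f e)).imp (fun h => .ex h (hH.refl (F.isLabel f e)))
            fun h => absurd h (hH.not_clash (hH.sym h4))
        · exact Or.inr (.negSing hfg)
    | exId a z =>
      simp only [RuleInst.premises, Set.singleton_subset_iff, mem_foldedSet] at hp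
      obtain ⟨e, rfl, h⟩ := hp
      refine ⟨.inl e, ?_⟩
      simp only [RuleInst.conclusions, List.mem_singleton, exists_eq_left,
        Set.singleton_subset_iff, inl_mem]
      rcases z with f | b
      · obtain ⟨b, h1, h2⟩ := F.of_ex_inl hH hΓ h
        obtain rfl := (F.eq_iff e f).1 (hH.mon (hH.exId h1) h2)
        exact .sing
      · obtain ⟨hb, hR, h1⟩ := F.of_ex_inr hΓ h
        exact absurd ⟨_, hH.sym (hH.exId (h1 e))⟩ hb
    | notExId a D =>
      simp only [RuleInst.premises, Set.singleton_subset_iff, mem_foldedSet] at hp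
      obtain ⟨e, rfl, h⟩ := hp
      refine ⟨.inl e, ?_⟩
      simp only [RuleInst.conclusions, List.mem_singleton, exists_eq_left,
        Set.singleton_subset_iff, inl_mem]
      rcases of_negEx hΓ h with ⟨C, hC, h0, rfl⟩ | ⟨g, c, h3, h4, rfl⟩
      · exact F.folded_of_mem (neg_mem_signed (hΓ.of_ex hC)) (hH.notExId (h0 e))
      · refine .negSing ?_
        rintro rfl
        exact hH.not_clash (hH.refl (F.isLabel e e))
          (hH.notSym (hH.mon (hH.sym h4) (hH.notSym (hH.notExId h3))))
    | ub a z =>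
      simp only [RuleInst.premises, Set.insert_subset_iff, Set.singleton_subset_iff,
        mem_foldedSet] at hp
      obtain ⟨⟨e, rfl, -⟩, f, rfl, -⟩ := hp
      refine ⟨.inl e, ?_⟩
      simp only [RuleInst.conclusions, List.mem_cons, List.not_mem_nil, or_false,
        exists_eq_or_imp, exists_eq_left, Set.singleton_subset_iff, inl_mem]
      by_cases hef : e = f
      · subst hef
        exact Or.inl .sing
      · exact Or.inr (.negSing hef)
  · rintro z p ⟨e, he, h⟩ h'
    dsimp only at he h
    subst he
    rw [inl_mem] at h'
    cases h with
    | base hC h hD =>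
      obtain rfl := Concept.map_eq_sym.1 hD.symm
      cases h' with
      | base hC' h' hD' =>
        obtain ⟨C', rfl, hC''⟩ := Concept.map_eq_neg.1 hD'.symm
        obtain rfl := Concept.map_eq_sym.1 hC''
        exact hH.not_clash (h e) (h' e)
  · rintro z z' ⟨e, he, h⟩ h'
    dsimp only at he h
    subst he
    rw [inl_mem] at h'
    obtain ⟨f, rfl, hef⟩ := F.of_negSing hH hΓ h'
    exact hef (Sum.inl.inj (F.of_sing hH h)).symm

end Folding

end

section

universe u v w

variable {O : Type u} {A : Type v} {Q : Type w}

/-! ### The finite model property -/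

/-- Every Hintikka set has a folding with finitely many labels. Its labels, up to the equality
`a : {b}`, are folded by `exists_finite_pairing`, the type of a label being the finite set of
concepts from `signed Γ` which it carries. -/
theorem Hintikka.exists_folding {H : Set (Labelled O A Q)} (hH : Hintikka H)
    {Γ : Set (Concept O A Q)} (hfin : Γ.Finite) :
    ∃ (E : Type (max u v w)) (_ : Finite E) (P : E → E → O) (σ : O → E ⊕ O), Folding H Γ P σ ∧
      ∀ a, IsLabel a H → ∃ e, σ a = .inl e ∧ ∀ C ∈ signed Γ, (a ⦂ C) ∈ H → (P e e ⦂ C) ∈ H := by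
  classical
  let s : Setoid {a // IsLabel a H} :=
    { r := fun a b => (a.1 ⦂ .sing b.1) ∈ H
      iseqv := ⟨fun a => hH.refl a.2, fun h => hH.sym h, fun h h' => hH.mon h h'⟩ }
  let rep : Quotient s → O := fun q => q.out.1
  have rep_isLabel : ∀ q, IsLabel (rep q) H := fun q => q.out.2
  have rep_mk : ∀ a, (rep (Quotient.mk s a) ⦂ .sing a.1) ∈ H := fun a => Quotient.mk_out a
  have rep_eq : ∀ q q', (rep q ⦂ .sing (rep q')) ∈ H ↔ q = q' := fun q q' =>
    Quotient.out_equiv_out (s := s)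
  have : Finite (signed Γ) := (hfin.union (hfin.image _)).to_subtype
  have : Finite Γ := hfin.to_subtype
  let tp : Quotient s → Set (signed Γ) := fun q => {C | (rep q ⦂ C.1) ∈ H}
  -- the witness operations, indexed by `Γ`; only concepts `∃R.C` matter
  have hW : ∀ (q : Quotient s) (x : Γ), ∃ q' : Quotient s, ∀ R C, x.1 = .ex R C →
      ¬ C.IsSingleton → (rep q ⦂ .ex R C) ∈ H →
      ∃ b, (rep q ⦂ .ex R (.sing b)) ∈ H ∧ (b ⦂ .sing (rep q')) ∈ H ∧ (rep q' ⦂ C) ∈ H := by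
    intro q x
    by_cases h : ∃ R C, x.1 = .ex R C ∧ ¬ C.IsSingleton ∧ (rep q ⦂ .ex R C) ∈ H
    · obtain ⟨R, C, hx, hC, h⟩ := h
      obtain ⟨b, h1, h2⟩ := hH.ex h hC
      have hb := rep_mk ⟨b, _, h2⟩
      refine ⟨Quotient.mk s ⟨b, _, h2⟩, fun R' C' hx' _ _ => ?_⟩
      obtain ⟨rfl, rfl⟩ := Concept.ex.inj (hx.symm.trans hx')
      exact ⟨b, h1, hH.sym hb, hH.mon hb h2⟩
    · exact ⟨q, fun R C hx hC h' => absurd ⟨R, C, hx, hC, h'⟩ h⟩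
  choose W hW using hW
  obtain ⟨E, hE, p, hp1, hp2, hp3, hp4⟩ := exists_finite_pairing tp W
  choose i hi using hp4
  have type_eq : ∀ e f g C, C ∈ signed Γ → (rep (p e f) ⦂ C) ∈ H → (rep (p e g) ⦂ C) ∈ H :=
    fun e f g C hC h => (Set.ext_iff.1 (hp1 e f g) ⟨C, hC⟩).1 h
  have rep_i : ∀ a C, C ∈ signed Γ → (a.1 ⦂ C) ∈ H →
      (rep (p (i (Quotient.mk s a)) (i (Quotient.mk s a))) ⦂ C) ∈ H := fun a C hC h =>
    (Set.ext_iff.1 (hi (Quotient.mk s a)) ⟨C, hC⟩).2 (hH.mon (rep_mk a) h)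
  refine ⟨E, hE, fun e f => rep (p e f),
    fun b => if h : IsLabel b H then .inl (i (Quotient.mk s ⟨b, h⟩)) else .inr b,
    ⟨fun e f => rep_isLabel _, type_eq, fun e f => (rep_eq _ _).trans (hp2 e f), ?_,
      fun b hb => dif_neg hb, ?_⟩, ?_⟩
  · intro e R C hx hC h
    obtain ⟨f, hf⟩ := hp3 e ⟨_, hx⟩
    obtain ⟨b, h1, h2, h3⟩ := hW (p e f) ⟨_, hx⟩ R C rfl hC
      (type_eq _ _ _ _ (mem_signed hx) h)
    rw [← hf] at h2 h3
    exact ⟨f, b, h1, h2, h3⟩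
  · intro b hb hl
    exact ⟨_, dif_pos hl, fun f => type_eq _ _ _ _ (mem_signed hb)
      (rep_i ⟨b, hl⟩ _ (mem_signed hb) (hH.refl hl))⟩
  · intro a ha
    exact ⟨_, dif_pos ha, fun C hC h => rep_i ⟨a, ha⟩ C hC h⟩

/-- The finite model property for Hintikka sets: the part of a Hintikka set which consists of
concepts from a finite set can be mapped, by a renaming of individuals, into a Hintikka set with
finitely many labels. -/
theorem Hintikka.exists_finite {H : Set (Labelled O A Q)} (hH : Hintikka H)
    {Γ : Set (Concept O A Q)} (hfin : Γ.Finite) (hΓ : SubClosed Γ) :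
    ∃ (O' : Type (max u v w)) (σ : O → O') (H' : Set (Labelled O' A Q)), Hintikka H' ∧
      {x | IsLabel x H'}.Finite ∧ ∀ L ∈ H, L.con ∈ Γ → L.map σ ∈ H' := by
  obtain ⟨E, hE, P, σ, F, hσ⟩ := hH.exists_folding hfin
  refine ⟨E ⊕ O, σ, foldedSet H Γ P σ, F.hintikka_foldedSet hH hΓ,
    (Set.finite_range Sum.inl).subset ?_, ?_⟩
  · rintro x ⟨C, e, he, -⟩
    exact ⟨e, he.symm⟩
  · rintro ⟨a, C⟩ h hC
    obtain ⟨e, he, heC⟩ := hσ a ⟨C, h⟩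
    exact ⟨e, he, F.folded_of_mem (mem_signed hC) (heC C (mem_signed hC) h)⟩

end

section

variable {O A Q : Type*}

/-! ### Individuals and concepts introduced by the rules -/

theorem Concept.finite_occurs (C : Concept O A Q) : {a | C.Occurs a}.Finite := by
  induction C with
  | sym p => exact Set.finite_empty
  | sing b => exact Set.finite_singleton b
  | neg C ih => exact ih
  | union C D ihC ihD => exact ihC.union ihD
  | ex R C ih => exact ih

theorem finite_occursIn {N : Set (Labelled O A Q)} (hN : N.Finite) :
    {a | OccursIn a N}.Finite := by
  refine (hN.biUnion fun L _ => (Set.finite_singleton L.ind).union L.con.finite_occurs).subset ?_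
  rintro a ⟨L, hL, ha⟩
  exact Set.mem_biUnion hL ha

theorem OccursIn.mono {N N' : Set (Labelled O A Q)} (h : N ⊆ N') {a : O} (ha : OccursIn a N) :
    OccursIn a N' := by
  obtain ⟨L, hL, ha⟩ := ha
  exact ⟨L, h hL, ha⟩

theorem IsLabel.mono {N N' : Set (Labelled O A Q)} (h : N ⊆ N') {a : O} (ha : IsLabel a N) :
    IsLabel a N' := by
  obtain ⟨C, hC⟩ := ha
  exact ⟨C, h hC⟩

namespace RuleInst

theorem finite_of_mem_conclusions {r : RuleInst O A Q} {w : O} {X : Set (Labelled O A Q)}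
    (hX : X ∈ r.conclusions w) : X.Finite := by
  cases r <;> simp only [conclusions, List.mem_cons, List.not_mem_nil, or_false] at hX <;>
    first | (subst hX; simp) | (rcases hX with rfl | rfl <;> simp)

/-- The only new individual in a conclusion is the one introduced by the rule `ex`, and it
is a label there. -/
theorem occursIn_of_mem_conclusions {r : RuleInst O A Q} {w b : O} {X : Set (Labelled O A Q)}
    (hX : X ∈ r.conclusions w) (hb : OccursIn b X) :
    OccursIn b r.premises ∨ r.IsEx ∧ b = w ∧ IsLabel b X := by
  have hw : ∀ L C, IsLabel w ({L, w ⦂ C} : Set (Labelled O A Q)) := fun L C => ⟨C, Or.inr rfl⟩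
  cases r <;> simp only [conclusions, List.mem_cons, List.not_mem_nil, or_false] at hX <;>
    first
    | (subst hX
       simp only [OccursIn, premises, IsEx, Set.mem_insert_iff, Set.mem_singleton_iff,
         exists_eq_or_imp, exists_eq_left, Concept.Occurs, false_and, or_false] at hb ⊢
       grind)
    | (rcases hX with rfl | rfl <;>
       (simp only [OccursIn, premises, IsEx, Set.mem_insert_iff, Set.mem_singleton_iff,
          exists_eq_or_imp, exists_eq_left, Concept.Occurs, false_and, or_false] at hb ⊢
        grind))

/-- A set `Γ` of concepts closed under subconcepts which contains `{b}` and, with `∃R.C`, also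
`∃R.{b}` for all individuals `b` is, up to a negation, closed under all rules. -/
theorem con_mem_signed_of_mem_conclusions {Γ : Set (Concept O A Q)} (hΓ : SubClosed Γ)
    (hsing : ∀ b, .sing b ∈ Γ) (hex : ∀ R C b, .ex R C ∈ Γ → .ex R (.sing b) ∈ Γ)
    {r : RuleInst O A Q} (hr : ∀ L ∈ r.premises, L.con ∈ signed Γ) {w : O}
    {X : Set (Labelled O A Q)} (hX : X ∈ r.conclusions w) : ∀ L ∈ X, L.con ∈ signed Γ := by
  have neg_iff : ∀ C, Concept.neg C ∈ signed Γ ↔ C ∈ Γ := fun C =>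
    ⟨hΓ.of_neg_mem_signed, neg_mem_signed⟩
  have pos : ∀ C, C ∈ Γ → C ∈ signed Γ := fun C => mem_signed
  obtain ⟨h1, h2, h3, h4, h5, h6⟩ := hΓ
  cases r <;> simp only [conclusions, List.mem_cons, List.not_mem_nil, or_false] at hX <;>
    first
    | (subst hX
       simp only [premises, Set.mem_insert_iff, Set.mem_singleton_iff, forall_eq_or_imp,
         forall_eq, neg_iff, ex_mem_signed, sing_mem_signed] at hr ⊢
       grind)
    | (rcases hX with rfl | rfl <;>
       (simp only [premises, Set.mem_insert_iff, Set.mem_singleton_iff, forall_eq_or_imp,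
          forall_eq, neg_iff, ex_mem_signed, union_mem_signed, sing_mem_signed] at hr ⊢
        grind))

/-- A rule instance is determined by its rule and its premises. -/
theorem finite_premises_subset {N : Set (Labelled O A Q)} (hN : N.Finite) :
    {r : RuleInst O A Q | r.premises ⊆ N}.Finite := by
  let code : RuleInst O A Q → ℕ × Labelled O A Q × Labelled O A Q := fun
    | clash a C => (0, a ⦂ C, a ⦂ .neg C)
    | notNot a C => (1, a ⦂ .neg (.neg C), a ⦂ .neg (.neg C))
    | notOr a C D => (2, a ⦂ .neg (.union C D), a ⦂ .neg (.union C D))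
    | or a C D => (3, a ⦂ .union C D, a ⦂ .union C D)
    | ex a R C => (4, a ⦂ .ex R C, a ⦂ .ex R C)
    | notEx a R C a' => (5, a ⦂ .neg (.ex R C), a ⦂ .ex R (.sing a'))
    | sym a a' => (6, a ⦂ .sing a', a ⦂ .sing a')
    | notSym a a' => (7, a ⦂ .neg (.sing a'), a ⦂ .neg (.sing a'))
    | mon a a' C => (8, a ⦂ .sing a', a' ⦂ C)
    | refl a C => (9, a ⦂ C, a ⦂ C)
    | exOr a R S a' => (10, a ⦂ .ex (.union R S) (.sing a'), a ⦂ .ex (.union R S) (.sing a'))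
    | notExOr a R S C => (11, a ⦂ .neg (.ex (.union R S) C), a ⦂ .neg (.ex (.union R S) C))
    | exInv a R a' => (12, a ⦂ .ex (.inv R) (.sing a'), a ⦂ .ex (.inv R) (.sing a'))
    | notExInv a R C a' => (13, a ⦂ .neg (.ex (.inv R) C), a' ⦂ .ex R (.sing a))
    | exNot a R a' => (14, a ⦂ .ex (.neg R) (.sing a'), a ⦂ .ex (.neg R) (.sing a'))
    | notExNot a R C a' => (15, a ⦂ .neg (.ex (.neg R) C), a' ⦂ .sing a')
    | exId a a' => (16, a ⦂ .ex .id (.sing a'), a ⦂ .ex .id (.sing a'))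
    | notExId a C => (17, a ⦂ .neg (.ex .id C), a ⦂ .neg (.ex .id C))
    | ub a a' => (18, a ⦂ .sing a, a' ⦂ .sing a')
  refine Set.Finite.of_finite_image (f := code)
    (((Set.finite_le_nat 18).prod (hN.prod hN)).subset ?_) ?_
  · rintro _ ⟨r, hr, rfl⟩
    cases r <;> simp_all [code, premises, Set.insert_subset_iff]
  · intro r _ s _ h
    cases r <;> cases s <;> cases h <;> rfl

end RuleInst

end

section

variable {O O' A Q : Type*}

namespace Tableau

variable {T : Tableau O A Q} {S : Set (Concept O A Q)} {B : Set Pos}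

/-! ### Branches of a derivation -/

namespace IsBranch

theorem mem_of_suffix (hB : T.IsBranch B) {p q : Pos} (hq : q ∈ B) (h : p <:+ q) : p ∈ B := by
  induction q with
  | nil => rwa [List.suffix_nil.1 h]
  | cons i q ih =>
    rcases List.suffix_cons_iff.1 h with rfl | h
    · exact hq
    · exact ih (hB.parent_mem i q hq) h

theorem eq_of_length_eq (hB : T.IsBranch B) : ∀ {p q : Pos}, p ∈ B → q ∈ B →
    p.length = q.length → p = q
  | [], [], _, _, _ => rfl
  | i :: p, j :: q, hp, hq, h => by
    obtain rfl := hB.eq_of_length_eq (hB.parent_mem i p hp) (hB.parent_mem j q hq)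
      (by simpa using h)
    rw [hB.unique_child i j p hp hq]

theorem suffix_of_length_le (hB : T.IsBranch B) {p q : Pos} (hp : p ∈ B) (hq : q ∈ B)
    (h : p.length ≤ q.length) : p <:+ q := by
  have hs := List.drop_suffix (q.length - p.length) q
  rwa [← hB.eq_of_length_eq hp (hB.mem_of_suffix hq hs) (by simp; omega)] at hs

theorem suffix_total (hB : T.IsBranch B) {p q : Pos} (hp : p ∈ B) (hq : q ∈ B) :
    p <:+ q ∨ q <:+ p :=
  (le_total p.length q.length).imp (hB.suffix_of_length_le hp hq)
    (hB.suffix_of_length_le hq hp)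

end IsBranch

namespace IsDerivation

theorem exists_of_cons_mem (hT : T.IsDerivation S) {i : ℕ} {p : Pos} (h : i :: p ∈ T.nodes) :
    p ∈ T.nodes ∧ ∃ r X, T.step p = some r ∧ X ∈ r.conclusions (T.witness p) ∧
      T.label (i :: p) = T.label p ∪ X := by
  obtain ⟨hp, r, hr, hi⟩ := (hT.children p i).1 h
  exact ⟨hp, r, _, hr, List.getElem_mem hi,
    hT.child_label p hp r hr i _ (List.getElem?_eq_getElem hi)⟩

theorem mem_of_suffix (hT : T.IsDerivation S) {p q : Pos} (hq : q ∈ T.nodes) (h : p <:+ q) :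
    p ∈ T.nodes ∧ T.label p ⊆ T.label q := by
  induction q with
  | nil => rw [List.suffix_nil.1 h]; exact ⟨hq, subset_rfl⟩
  | cons i q ih =>
    rcases List.suffix_cons_iff.1 h with rfl | h
    · exact ⟨hq, subset_rfl⟩
    · obtain ⟨hq', r, X, -, -, hl⟩ := hT.exists_of_cons_mem hq
      obtain ⟨hp, hpq⟩ := ih hq' h
      exact ⟨hp, hpq.trans (hl ▸ Set.subset_union_left)⟩

theorem finite_label (hT : T.IsDerivation S) (hS : S.Finite) {p : Pos} (hp : p ∈ T.nodes) :
    (T.label p).Finite := by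
  induction p with
  | nil =>
    obtain ⟨a, -, h⟩ := hT.root_label
    rw [h]
    refine (hS.image fun C => a ⦂ C.preprocess).subset ?_
    rintro _ ⟨C, hC, rfl⟩
    exact ⟨C, hC, rfl⟩
  | cons i p ih =>
    obtain ⟨hp', r, X, -, hX, hl⟩ := hT.exists_of_cons_mem hp
    rw [hl]
    exact (ih hp').union (RuleInst.finite_of_mem_conclusions hX)

theorem label_subset_of_suffix (hT : T.IsDerivation S) (hB : T.IsBranch B) {p q : Pos}
    (hq : q ∈ B) (h : p <:+ q) : T.label p ⊆ T.label q :=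
  (hT.mem_of_suffix (hB.subset hq) h).2

/-- In a branch, every rule instance is applied at most once. -/
theorem eq_of_step_eq (hT : T.IsDerivation S) (hB : T.IsBranch B) {p q : Pos} (hp : p ∈ B)
    (hq : q ∈ B) {r : RuleInst O A Q} (hpr : T.step p = some r) (hqr : T.step q = some r) :
    p = q := by
  by_contra hne
  rcases hB.suffix_total hp hq with h | h
  · exact hT.once p (hB.subset hp) q (hB.subset hq) h hne r hpr hqr
  · exact hT.once q (hB.subset hq) p (hB.subset hp) h (Ne.symm hne) r hqr hpr

/-- If a rule other than the closure rule is applied in a branch, then the branch contains one of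
the alternative sets of conclusions. -/
theorem exists_conclusion_subset (hT : T.IsDerivation S) (hB : T.IsBranch B) {p : Pos}
    (hp : p ∈ B) {r : RuleInst O A Q} (hr : T.step p = some r) (hc : ¬ r.IsClosure) :
    ∃ i, i :: p ∈ B ∧ ∃ X ∈ r.conclusions (T.witness p), X ⊆ T.label (i :: p) := by
  have h0 : 0 < (r.conclusions (T.witness p)).length := by
    cases r <;> first | exact absurd trivial hc | simp [RuleInst.conclusions]
  obtain ⟨i, hi⟩ := hB.maximal 0 p hp ((hT.children p 0).2 ⟨hB.subset hp, r, hr, h0⟩)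
  obtain ⟨-, r', X, hr', hX, hl⟩ := hT.exists_of_cons_mem (hB.subset hi)
  obtain rfl := Option.some.inj (hr.symm.trans hr')
  exact ⟨i, hi, X, hX, hl ▸ Set.subset_union_right⟩

end IsDerivation

theorem occursIn_content {a : O} : OccursIn a (T.content B) ↔ ∃ p ∈ B, OccursIn a (T.label p) := by
  constructor
  · rintro ⟨L, ⟨p, hp, hL⟩, ha⟩
    exact ⟨p, hp, L, hL, ha⟩
  · rintro ⟨p, hp, L, hL, ha⟩
    exact ⟨L, ⟨p, hp, hL⟩, ha⟩

/-! ### The content of an open branch -/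

/-- The introduction order is well-founded, as every node contains finitely many individuals. -/
theorem IsIntroOrder.exists_minimal {lt : O → O → Prop} (hT : T.IsDerivation S) (hS : S.Finite)
    (hB : T.IsBranch B) (hlt : T.IsIntroOrder B lt) {M : Set O}
    (hM : ∀ a ∈ M, OccursIn a (T.content B)) (hne : M.Nonempty) :
    ∃ m ∈ M, ∀ x ∈ M, ¬ lt x m := by
  obtain ⟨a, ha⟩ := hne
  obtain ⟨p, hp, hap⟩ := occursIn_content.1 (hM a ha)
  let F := {x // x ∈ M ∧ OccursIn x (T.label p)}
  have : Finite F := ((finite_occursIn (hT.finite_label hS (hB.subset hp))).subset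
    fun x hx => hx.2 : {x | x ∈ M ∧ OccursIn x (T.label p)}.Finite).to_subtype
  let r : F → F → Prop := fun x y => lt x.1 y.1
  have : IsTrans F r := ⟨fun x y z => hlt.trans _ _ _ (hM _ x.2.1) (hM _ y.2.1) (hM _ z.2.1)⟩
  have : Std.Irrefl r := ⟨fun x => hlt.irrefl _ (hM _ x.2.1)⟩
  obtain ⟨m, -, hm⟩ := (Finite.wellFounded_of_trans_of_irrefl r).has_min Set.univ
    ⟨⟨a, ha, hap⟩, trivial⟩
  refine ⟨m.1, m.2.1, fun x hx hxm => ?_⟩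
  by_cases hxp : OccursIn x (T.label p)
  · exact hm ⟨x, hx, hxp⟩ trivial hxm
  · have hmx := hlt.extends_intro m.1 x (hM x hx) ⟨p, hp, m.2.2, hxp⟩
    exact hlt.irrefl x (hM x hx) (hlt.trans _ _ _ (hM _ hx) (hM _ m.2.1) (hM _ hx) hxm hmx)

/-- The content of a fully expanded open branch is a Hintikka set. An application of `ex` to
`a : ∃R.C` forbidden by (c1) is not needed, because the rule is applied to the least individual
which is equal to `a` in the branch, and the conclusions are transferred to `a`. -/
theorem hintikka_content {lt : O → O → Prop} (hT : T.IsDerivation S) (hS : S.Finite)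
    (hB : T.IsBranch B) (hlt : T.IsIntroOrder B lt) (hopen : ¬ T.ClosedBranch B)
    (hexp : T.FullyExpanded B lt) : Hintikka (T.content B) := by
  have key : ∀ r : RuleInst O A Q, r.Applicable (T.content B) →
      ¬ r.Blocked lt (T.content B) → ∃ w, ∃ X ∈ r.conclusions w, X ⊆ T.content B := by
    intro r hr hb
    rcases hexp r hr hb with ⟨p, hp, hpr⟩ | ⟨-, h⟩
    · obtain ⟨i, hi, X, hX, hXl⟩ := hT.exists_conclusion_subset hB hp hpr
        fun hc => hopen ⟨p, hp, r, hpr, hc⟩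
      exact ⟨_, X, hX, fun L hL => ⟨_, hi, hXl hL⟩⟩
    · exact h
  have key' : ∀ r : RuleInst O A Q, r.premises ⊆ T.content B → ¬ r.IsEx →
      ∃ w, ∃ X ∈ r.conclusions w, X ⊆ T.content B := by
    intro r hr hex
    exact key r ⟨hr, by rintro _ _ _ rfl; exact absurd trivial hex⟩
      (by rintro ⟨_, _, _, _, rfl, -⟩; exact hex trivial)
  have refl : ∀ a C, (a ⦂ C) ∈ T.content B → (a ⦂ .sing a) ∈ T.content B := by
    intro a C h
    obtain ⟨w, X, hX, hXB⟩ := key' (.refl a C) (by simpa [RuleInst.premises] using h) id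
    obtain rfl : X = _ := by simpa [RuleInst.conclusions] using hX
    simpa using hXB
  have sym : ∀ a b, (a ⦂ .sing b) ∈ T.content B → (b ⦂ .sing a) ∈ T.content B := by
    intro a b h
    obtain ⟨w, X, hX, hXB⟩ := key' (.sym a b) (by simpa [RuleInst.premises] using h) id
    obtain rfl : X = _ := by simpa [RuleInst.conclusions] using hX
    simpa using hXB
  have mon : ∀ a b C, (a ⦂ .sing b) ∈ T.content B → (b ⦂ C) ∈ T.content B →
      (a ⦂ C) ∈ T.content B := by
    intro a b C h h'
    obtain ⟨w, X, hX, hXB⟩ := key' (.mon a b C)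
      (by simpa [RuleInst.premises, Set.insert_subset_iff] using ⟨h, h'⟩) id
    obtain rfl : X = _ := by simpa [RuleInst.conclusions] using hX
    simpa using hXB
  intro r hr
  by_cases hex : r.IsEx
  · cases r with
    | ex a R C =>
      have ha : (a ⦂ .ex R C) ∈ T.content B := hr.1 rfl
      have hC := hr.2 a R C rfl
      obtain ⟨m, hm, hmin⟩ := hlt.exists_minimal hT hS hB
        (M := {x | (x ⦂ .sing a) ∈ T.content B}) (fun x hx => ⟨_, hx, Or.inl rfl⟩)
        ⟨a, refl a _ ha⟩
      obtain ⟨w, X, hX, hXB⟩ := key (.ex m R C)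
        ⟨by simpa [RuleInst.premises] using mon _ _ _ hm ha, by rintro _ _ _ ⟨⟩; exact hC⟩
        (by rintro ⟨x, _, _, _, ⟨⟩, hx, hxm⟩; exact hmin x (mon _ _ _ hxm hm) hx)
      obtain rfl : X = _ := by simpa [RuleInst.conclusions] using hX
      refine ⟨w, _, List.mem_singleton.2 rfl, ?_⟩
      rw [Set.insert_subset_iff, Set.singleton_subset_iff] at hXB ⊢
      exact ⟨mon _ _ _ (sym _ _ hm) hXB.1, hXB.2⟩
    | _ => exact hex.elim
  · exact key' r hr.1 hex

/-! ### The branch guided by a Hintikka set -/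

/-- Expanding a node which is mapped into a Hintikka set: one of its successors is mapped into the
Hintikka set as well, where only the new individual has to be mapped afresh. -/
theorem exists_guided_child (hT : T.IsDerivation S) {H : Set (Labelled O' A Q)}
    (hH : Hintikka H) {p : Pos} (hp : p ∈ T.nodes) {r : RuleInst O A Q} (hr : T.step p = some r)
    {σ : O → O'} (hσ : ∀ L ∈ T.label p, L.map σ ∈ H) :
    ∃ x : (O → O') × ℕ, x.2 :: p ∈ T.nodes ∧ (∀ b, OccursIn b (T.label p) → x.1 b = σ b) ∧
      ∀ L ∈ T.label (x.2 :: p), L.map x.1 ∈ H := by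
  classical
  have happ := hT.applicable p hp r hr
  obtain ⟨w', X', hX', hX'H⟩ := hH (r.map σ) ⟨by
    rw [RuleInst.premises_map]
    rintro _ ⟨L, hL, rfl⟩
    exact hσ L (happ.1 hL), by
    intro a R C h
    cases r with
    | ex a R C =>
      obtain ⟨-, -, rfl⟩ := RuleInst.ex.inj h
      rw [Concept.isSingleton_map]
      exact happ.2 _ _ _ rfl
    | _ => cases h⟩
  obtain ⟨τ, hτ, hτX⟩ : ∃ τ : O → O', (∀ b, OccursIn b (T.label p) → τ b = σ b) ∧
      X' ∈ (r.map τ).conclusions (τ (T.witness p)) := by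
    by_cases hex : r.IsEx
    · cases r with
      | ex a R C =>
        have hw := hT.fresh p hp _ hr trivial
        have hl : (a ⦂ .ex R C) ∈ T.label p := happ.1 rfl
        have hne : ∀ b, OccursIn b (T.label p) →
            Function.update σ (T.witness p) w' b = σ b := fun b hb =>
          Function.update_of_ne (by rintro rfl; exact hw hb) _ _
        refine ⟨Function.update σ (T.witness p) w', hne, ?_⟩
        rw [Function.update_self, RuleInst.map, hne a ⟨_, hl, Or.inl rfl⟩,
          Concept.map_congr (C := C) fun b hb => hne b ⟨_, hl, Or.inr hb⟩]
        exact hX'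
      | _ => exact hex.elim
    · refine ⟨σ, fun _ _ => rfl, ?_⟩
      rwa [RuleInst.conclusions_congr (by rwa [RuleInst.isEx_map]) _ w']
  rw [RuleInst.conclusions_map, List.mem_map] at hτX
  obtain ⟨X, hX, rfl⟩ := hτX
  obtain ⟨i, hi, rfl⟩ := List.mem_iff_getElem.1 hX
  refine ⟨(τ, i), (hT.children p i).2 ⟨hp, r, hr, hi⟩, hτ, fun L hL => ?_⟩
  rw [hT.child_label p hp r hr i _ (List.getElem?_eq_getElem hi)] at hL
  rcases hL with hL | hL
  · rw [Labelled.map_congr (hτ _ ⟨L, hL, Or.inl rfl⟩) fun b hb => hτ b ⟨L, hL, Or.inr hb⟩]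
    exact hσ L hL
  · exact hX'H ⟨L, hL, rfl⟩

/-- If the root of a derivation is mapped into a Hintikka set by a renaming of individuals, then so
is, by another renaming, some branch. -/
theorem exists_guided_branch (hT : T.IsDerivation S) {H : Set (Labelled O' A Q)}
    (hH : Hintikka H) {σ₀ : O → O'} (hσ₀ : ∀ L ∈ T.label [], L.map σ₀ ∈ H) :
    ∃ B, T.IsBranch B ∧ ∃ σ : O → O', ∀ L ∈ T.content B, L.map σ ∈ H := by
  classical
  -- the guided choice of a renaming and a successor, for each node and renaming
  have hnext : ∀ (p : Pos) (σ : O → O'), ∃ x : (O → O') × ℕ, ∀ r, p ∈ T.nodes →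
      T.step p = some r → (∀ L ∈ T.label p, L.map σ ∈ H) →
      x.2 :: p ∈ T.nodes ∧ (∀ b, OccursIn b (T.label p) → x.1 b = σ b) ∧
        ∀ L ∈ T.label (x.2 :: p), L.map x.1 ∈ H := by
    intro p σ
    by_cases h : ∃ r, p ∈ T.nodes ∧ T.step p = some r ∧ ∀ L ∈ T.label p, L.map σ ∈ H
    · obtain ⟨r, hp, hr, hσ⟩ := h
      obtain ⟨x, hx⟩ := exists_guided_child hT hH hp hr hσ
      exact ⟨x, fun _ _ _ _ => hx⟩
    · exact ⟨(σ, 0), fun r hp hr hσ => absurd ⟨r, hp, hr, hσ⟩ h⟩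
  choose next hnext using hnext
  let τ : Pos → O → O' := fun p => List.rec σ₀ (fun _ q σ => (next q σ).1) p
  have τ_cons : ∀ i p, τ (i :: p) = (next p (τ p)).1 := fun _ _ => rfl
  let B : Set Pos := {p | p ∈ T.nodes ∧ ∀ i q, i :: q <:+ p → i = (next q (τ q)).2}
  have cons_mem : ∀ i p, i :: p ∈ B ↔ i :: p ∈ T.nodes ∧ p ∈ B ∧ i = (next p (τ p)).2 := by
    intro i p
    constructor
    · rintro ⟨h, h'⟩
      exact ⟨h, ⟨(hT.exists_of_cons_mem h).1,
        fun j q hq => h' j q (hq.trans (List.suffix_cons i p))⟩, h' i p List.suffix_rfl⟩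
    · rintro ⟨h, hp, hi⟩
      refine ⟨h, fun j q hq => ?_⟩
      rcases List.suffix_cons_iff.1 hq with hq | hq
      · obtain ⟨rfl, rfl⟩ := List.cons.inj hq
        exact hi
      · exact hp.2 j q hq
  have hτ : ∀ p ∈ B, ∀ L ∈ T.label p, L.map (τ p) ∈ H := by
    intro p
    induction p with
    | nil => exact fun _ => hσ₀
    | cons i p ih =>
      intro h
      obtain ⟨h, hp, rfl⟩ := (cons_mem i p).1 h
      obtain ⟨hp', r, X, hr, -⟩ := hT.exists_of_cons_mem h
      exact (hnext p (τ p) r hp' hr (ih hp)).2.2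
  have hB : T.IsBranch B := by
    refine ⟨fun p hp => hp.1, ⟨hT.root_mem, fun i q h => ?_⟩,
      fun i p h => ((cons_mem i p).1 h).2.1,
      fun i j p hi hj => ((cons_mem i p).1 hi).2.2.trans ((cons_mem j p).1 hj).2.2.symm,
      fun i p hp h => ?_⟩
    · simp at h
    · obtain ⟨hp', r, X, hr, -⟩ := hT.exists_of_cons_mem h
      exact ⟨_, (cons_mem _ p).2 ⟨(hnext p (τ p) r hp' hr (hτ p hp)).1, hp, rfl⟩⟩
  have τ_eq : ∀ p q, q ∈ B → p <:+ q → ∀ b, OccursIn b (T.label p) → τ q b = τ p b := by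
    intro p q
    induction q with
    | nil => intro _ h b _; rw [List.suffix_nil.1 h]
    | cons i q ih =>
      intro hq h b hb
      rcases List.suffix_cons_iff.1 h with rfl | h'
      · rfl
      · obtain ⟨hq', hqB, rfl⟩ := (cons_mem i q).1 hq
        obtain ⟨hqn, r, X, hr, -⟩ := hT.exists_of_cons_mem hq'
        rw [τ_cons (next q (τ q)).2 q, ← ih hqB h' b hb]
        exact (hnext q (τ q) r hqn hr (hτ q hqB)).2.1 b
          (hb.mono (hT.label_subset_of_suffix hB hqB h'))
  refine ⟨B, hB,
    fun b => if h : ∃ p ∈ B, OccursIn b (T.label p) then τ h.choose b else σ₀ b, ?_⟩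
  rintro L ⟨p, hp, hL⟩
  have heq : ∀ b, OccursIn b (T.label p) →
      (if h : ∃ p ∈ B, OccursIn b (T.label p) then τ h.choose b else σ₀ b) = τ p b := by
    intro b hb
    have h : ∃ p ∈ B, OccursIn b (T.label p) := ⟨p, hp, hb⟩
    rw [dif_pos h]
    rcases hB.suffix_total hp h.choose_spec.1 with hs | hs
    · exact τ_eq _ _ h.choose_spec.1 hs b hb
    · exact (τ_eq _ _ hp hs b h.choose_spec.2).symm
  rw [Labelled.map_congr (heq _ ⟨L, hL, Or.inl rfl⟩) fun b hb => heq b ⟨L, hL, Or.inr hb⟩]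
  exact hτ p hp L hL

/-- A branch which can be mapped into a Hintikka set is open. -/
theorem not_closedBranch (hT : T.IsDerivation S) (hB : T.IsBranch B) {H : Set (Labelled O' A Q)}
    (hH : Hintikka H) {σ : O → O'} (hσ : ∀ L ∈ T.content B, L.map σ ∈ H) :
    ¬ T.ClosedBranch B := by
  rintro ⟨p, hp, r, hr, hc⟩
  have := (hT.applicable p (hB.subset hp) r hr).1
  cases r with
  | clash a C =>
    exact hH.not_clash (hσ _ ⟨p, hp, this (Or.inl rfl)⟩) (hσ _ ⟨p, hp, this (Or.inr rfl)⟩)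
  | _ => exact hc.elim

end Tableau

end

section

variable {O O' A Q : Type*}

namespace Tableau

variable {T : Tableau O A Q} {S : Set (Concept O A Q)} {B : Set Pos}

/-! ### Finiteness of guided branches -/

/-- Individuals do not occur in a node before they label an expression, except those of the
root. -/
theorem occursIn_root_or_isLabel (hT : T.IsDerivation S) {p : Pos} (hp : p ∈ T.nodes) {b : O}
    (hb : OccursIn b (T.label p)) : OccursIn b (T.label []) ∨ IsLabel b (T.label p) := by
  induction p with
  | nil => exact Or.inl hb
  | cons i p ih =>
    obtain ⟨hp', r, X, hr, hX, hl⟩ := hT.exists_of_cons_mem hp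
    have of_parent : OccursIn b (T.label p) →
        OccursIn b (T.label []) ∨ IsLabel b (T.label (i :: p)) := fun h =>
      (ih hp' h).imp_right fun h => h.mono (hl ▸ Set.subset_union_left)
    obtain ⟨L, hL, hLb⟩ := hb
    rw [hl] at hL
    rcases hL with hL | hL
    · exact of_parent ⟨L, hL, hLb⟩
    · rcases RuleInst.occursIn_of_mem_conclusions hX ⟨L, hL, hLb⟩ with h | ⟨-, -, h⟩
      · exact of_parent (h.mono (hT.applicable p hp' r hr).1)
      · exact Or.inr (h.mono (hl ▸ Set.subset_union_right))

/-- The concepts which may appear in a tableau, up to negation: those of a set `Γ`, the singletons,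
and the concepts `∃R.{b}` for the roles `R` in `Γ`. -/
def extend (Γ : Set (Concept O A Q)) : Set (Concept O A Q) :=
  {D | D ∈ Γ ∨ (∃ b, D = .sing b) ∨ ∃ R C b, .ex R C ∈ Γ ∧ D = .ex R (.sing b)}

theorem subClosed_extend {Γ : Set (Concept O A Q)} (hΓ : SubClosed Γ) : SubClosed (extend Γ) := by
  constructor
  · rintro C (h | ⟨b, ⟨⟩⟩ | ⟨R, D, b, h, ⟨⟩⟩)
    exact Or.inl (hΓ.of_neg h)
  · rintro C D (h | ⟨b, ⟨⟩⟩ | ⟨R, D, b, h, ⟨⟩⟩)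
    exact ⟨Or.inl (hΓ.of_union h).1, Or.inl (hΓ.of_union h).2⟩
  · rintro R C (h | ⟨b, ⟨⟩⟩ | ⟨R, D, b, h, ⟨⟩⟩)
    · exact Or.inl (hΓ.of_ex h)
    · exact Or.inr (Or.inl ⟨b, rfl⟩)
  · rintro R S C (h | ⟨b, ⟨⟩⟩ | ⟨R, D, b, h, ⟨⟩⟩)
    · exact ⟨Or.inl (hΓ.of_exUnion h).1, Or.inl (hΓ.of_exUnion h).2⟩
    · exact ⟨Or.inr (Or.inr ⟨_, D, b, (hΓ.of_exUnion h).1, rfl⟩),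
        Or.inr (Or.inr ⟨_, D, b, (hΓ.of_exUnion h).2, rfl⟩)⟩
  · rintro R C (h | ⟨b, ⟨⟩⟩ | ⟨R, D, b, h, ⟨⟩⟩)
    · exact Or.inl (hΓ.of_exInv h)
    · exact Or.inr (Or.inr ⟨_, D, b, hΓ.of_exInv h, rfl⟩)
  · rintro R C (h | ⟨b, ⟨⟩⟩ | ⟨R, D, b, h, ⟨⟩⟩)
    · exact Or.inl (hΓ.of_exNeg h)
    · exact Or.inr (Or.inr ⟨_, D, b, hΓ.of_exNeg h, rfl⟩)

theorem con_mem_extend (hT : T.IsDerivation S) {Γ : Set (Concept O A Q)} (hΓ : SubClosed Γ)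
    (hroot : ∀ L ∈ T.label [], L.con ∈ Γ) {p : Pos} (hp : p ∈ T.nodes) :
    ∀ L ∈ T.label p, L.con ∈ signed (extend Γ) := by
  induction p with
  | nil => exact fun L hL => mem_signed (Or.inl (hroot L hL))
  | cons i p ih =>
    obtain ⟨hp', r, X, hr, hX, hl⟩ := hT.exists_of_cons_mem hp
    rw [hl]
    rintro L (hL | hL)
    · exact ih hp' L hL
    · refine RuleInst.con_mem_signed_of_mem_conclusions (subClosed_extend hΓ)
        (fun b => Or.inr (Or.inl ⟨b, rfl⟩)) ?_
        (fun L hL => ih hp' L ((hT.applicable p hp' r hr).1 hL)) hX L hL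
      rintro R C b (h | ⟨b, ⟨⟩⟩ | ⟨R, D, b, h, ⟨⟩⟩)
      · exact Or.inr (Or.inr ⟨R, C, b, h, rfl⟩)
      · exact Or.inr (Or.inr ⟨R, D, _, h, rfl⟩)

/-- Only finitely many concepts over finitely many individuals may appear in a tableau. -/
theorem finite_extend {Γ : Set (Concept O A Q)} (hΓ : Γ.Finite) {I : Set O} (hI : I.Finite) :
    {C ∈ signed (extend Γ) | ∀ a, C.Occurs a → a ∈ I}.Finite := by
  have hfin : {C ∈ extend Γ | ∀ a, C.Occurs a → a ∈ I}.Finite := by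
    let f : Concept O A Q × O → Concept O A Q := fun x =>
      match x.1 with
      | .ex R _ => .ex R (.sing x.2)
      | D => D
    refine (hΓ.union ((hI.image Concept.sing).union ((hΓ.prod hI).image f))).subset ?_
    rintro _ ⟨h | ⟨b, rfl⟩ | ⟨R, C, b, h, rfl⟩, hocc⟩
    · exact Or.inl h
    · exact Or.inr (Or.inl ⟨b, hocc b rfl, rfl⟩)
    · exact Or.inr (Or.inr ⟨(_, b), ⟨h, hocc b rfl⟩, rfl⟩)
  refine (hfin.union (hfin.image Concept.neg)).subset ?_
  rintro _ ⟨h | ⟨C, h, rfl⟩, hocc⟩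
  · exact Or.inl ⟨h, hocc⟩
  · exact Or.inr ⟨C, ⟨h, hocc⟩, rfl⟩

/-- In an open branch guided by `σ`, rule `ub` decides equality of labels as `σ` does. -/
theorem sing_mem_of_ub (hT : T.IsDerivation S) (hB : T.IsBranch B) {H : Set (Labelled O' A Q)}
    (hH : Hintikka H) {σ : O → O'} (hσ : ∀ L ∈ T.content B, L.map σ ∈ H) {p : Pos} (hp : p ∈ B)
    {a a' : O} (ha : IsLabel a (T.label p)) (heq : σ a = σ a')
    (hub : (∃ q, q <:+ p ∧ q ≠ p ∧ T.step q = some (.ub a a')) ∨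
      (RuleInst.ub a a').Redundant (T.label p)) : (a ⦂ .sing a') ∈ T.label p := by
  have hX : ∀ w, ∀ X ∈ (RuleInst.ub a a' : RuleInst O A Q).conclusions w, X ⊆ T.label p →
      (a ⦂ .sing a') ∈ T.label p := by
    intro w X hX hXp
    simp only [RuleInst.conclusions, List.mem_cons, List.not_mem_nil, or_false] at hX
    rcases hX with rfl | rfl
    · exact hXp rfl
    · -- the other alternative would be mapped to a clash
      exfalso
      obtain ⟨C, hC⟩ := ha
      have h1 := hH.refl ⟨_, hσ _ ⟨p, hp, hC⟩⟩
      have h2 := hσ _ ⟨p, hp, hXp rfl⟩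
      simp only [Labelled.map, Concept.map, ← heq] at h1 h2
      exact hH.not_clash h1 h2
  rcases hub with ⟨q, hqp, hne, hq⟩ | ⟨-, w, X, hXc, hXp⟩
  · have hqB := hB.mem_of_suffix hp hqp
    obtain ⟨i, hi, X, hXc, hXi⟩ := hT.exists_conclusion_subset hB hqB hq id
    refine hX _ X hXc (hXi.trans (hT.label_subset_of_suffix hB hp ?_))
    refine hB.suffix_of_length_le hi hp ?_
    rcases hqp.length_le.lt_or_eq with h | h
    · simpa using h
    · exact absurd (hqp.eq_of_length h) hne
  · exact hX w X hXc hXp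

/-- In a branch guided by a Hintikka set with finitely many labels, the rule `ex` is applied
finitely often: after the node provided by (c2), condition (c1) restricts it to individuals
of the root and at most one further individual for each label of the Hintikka set. -/
theorem finite_isEx (hT : T.IsDerivation S) (hS : S.Finite) (hB : T.IsBranch B)
    {H : Set (Labelled O' A Q)} (hH : Hintikka H) (hfin : {x | IsLabel x H}.Finite)
    {σ : O → O'} (hσ : ∀ L ∈ T.content B, L.map σ ∈ H) {lt : O → O → Prop}
    (hlt : T.IsIntroOrder B lt) (hc1 : T.CondC1 B lt) (hc2 : T.CondC2 B)
    {Γ : Set (Concept O A Q)} (hΓfin : Γ.Finite) (hΓ : SubClosed Γ)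
    (hroot : ∀ L ∈ T.label [], L.con ∈ Γ) :
    {p ∈ B | ∃ r, T.step p = some r ∧ r.IsEx}.Finite := by
  obtain ⟨p₀, hp₀, hub⟩ := hc2
  let I : Set O := {a | ∃ p ∈ B, p₀ <:+ p ∧ ∃ R C, T.step p = some (.ex a R C)}
  have hprem : ∀ p ∈ B, ∀ a R C, T.step p = some (.ex a R C) → (a ⦂ .ex R C) ∈ T.label p :=
    fun p hp a R C h => (hT.applicable p (hB.subset hp) _ h).1 rfl
  -- of two such individuals with the same image, the one expanded first is the only one
  have hinj : ∀ p q a a' R R' C C', p ∈ B → q ∈ B → p <:+ q → p₀ <:+ p →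
      T.step p = some (.ex a R C) → T.step q = some (.ex a' R' C') →
      ¬ OccursIn a' (T.label []) → σ a = σ a' → a = a' := by
    intro p q a a' R R' C C' hp hq hpq h0 hpr hqr hroot' heq
    have hap : IsLabel a (T.label p) := ⟨_, hprem p hp a R C hpr⟩
    have haq : IsLabel a (T.label q) := hap.mono (hT.label_subset_of_suffix hB hq hpq)
    have ha'q : IsLabel a' (T.label q) := ⟨_, hprem q hq a' R' C' hqr⟩
    have occ : ∀ {b r}, r ∈ B → IsLabel b (T.label r) → OccursIn b (T.content B) :=
      fun hr ⟨_, hC⟩ => ⟨_, ⟨_, hr, hC⟩, Or.inl rfl⟩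
    have hq' := sing_mem_of_ub hT hB hH hσ hq haq heq
      (hub q hq (h0.trans hpq) _ hqr trivial a a' haq ha'q)
    have hna : ¬ lt a a' := fun h => hc1 q hq _ hqr ⟨a, a', R', C', rfl, h, hq'⟩
    rcases hlt.total a a' (occ hp hap) (occ hq ha'q) with h | h | h
    · exact absurd h hna
    · exact h
    · exfalso
      by_cases ha'p : OccursIn a' (T.label p)
      · have ha'l := (occursIn_root_or_isLabel hT (hB.subset hp) ha'p).resolve_left hroot'
        exact hc1 p hp _ hpr ⟨a', a, R, C, rfl, h, sing_mem_of_ub hT hB hH hσ hp ha'l heq.symm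
          (hub p hp h0 _ hpr trivial a' a ha'l hap)⟩
      · obtain ⟨D, hD⟩ := hap
        exact hna (hlt.extends_intro a a' (occ hq ha'q) ⟨p, hp, ⟨_, hD, Or.inl rfl⟩, ha'p⟩)
  have hIfin : I.Finite := by
    have h1 := finite_occursIn (hT.finite_label hS hT.root_mem)
    have h2 : {a ∈ I | ¬ OccursIn a (T.label [])}.Finite := by
      refine Set.Finite.of_finite_image (f := σ) (hfin.subset ?_) ?_
      · rintro _ ⟨a, ⟨⟨p, hp, -, R, C, h⟩, -⟩, rfl⟩
        exact ⟨_, hσ _ ⟨p, hp, hprem p hp a R C h⟩⟩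
      · rintro a ⟨⟨p, hp, h0p, R, C, hpr⟩, hra⟩ a' ⟨⟨q, hq, h0q, R', C', hqr⟩, hra'⟩ heq
        rcases hB.suffix_total hp hq with h | h
        · exact hinj p q a a' R R' C C' hp hq h h0p hpr hqr hra' heq
        · exact (hinj q p a' a R' R C' C hq hp h h0q hqr hpr hra heq.symm).symm
    refine (h1.union h2).subset fun a ha => ?_
    by_cases h : OccursIn a (T.label [])
    · exact Or.inl h
    · exact Or.inr ⟨ha, h⟩
  have h1 : {p | p <:+ p₀}.Finite :=
    (p₀.tails.finite_toSet).subset fun p hp => (List.mem_tails _ _).2 hp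
  have h2 : {p ∈ B | p₀ <:+ p ∧ ∃ r, T.step p = some r ∧ r.IsEx}.Finite := by
    let f : O × Concept O A Q → Option (RuleInst O A Q) := fun x =>
      match x.2 with
      | .ex R C => some (.ex x.1 R C)
      | _ => none
    refine Set.Finite.of_finite_image (f := T.step)
      (((hIfin.prod hΓfin).image f).subset ?_) ?_
    · rintro _ ⟨p, ⟨hp, h0, r, hr, hex⟩, rfl⟩
      cases r with
      | ex a R C =>
        refine ⟨(a, .ex R C), ⟨⟨p, hp, h0, R, C, hr⟩, ?_⟩, hr.symm⟩
        have hmem := con_mem_extend hT hΓ hroot (hB.subset hp) _ (hprem p hp a R C hr)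
        rw [ex_mem_signed] at hmem
        rcases hmem with h | ⟨b, ⟨⟩⟩ | ⟨R, D, b, h, ⟨⟩⟩
        · exact h
        · exact absurd ⟨b, rfl⟩ ((hT.applicable p (hB.subset hp) _ hr).2 _ _ _ rfl)
      | _ => exact hex.elim
    · rintro p ⟨hp, -, r, hr, -⟩ q ⟨hq, -⟩ h
      exact hT.eq_of_step_eq hB hp hq hr (h ▸ hr)
  refine (h1.union h2).subset ?_
  rintro p ⟨hp, hex⟩
  exact (hB.suffix_total hp hp₀).imp id fun h => ⟨hp, h, hex⟩

/-- A branch in which the rule `ex` is applied finitely often is finite. -/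
theorem finite_of_finite_isEx (hT : T.IsDerivation S) (hS : S.Finite) (hB : T.IsBranch B)
    (hex : {p ∈ B | ∃ r, T.step p = some r ∧ r.IsEx}.Finite)
    {Γ : Set (Concept O A Q)} (hΓfin : Γ.Finite) (hΓ : SubClosed Γ)
    (hroot : ∀ L ∈ T.label [], L.con ∈ Γ) : B.Finite := by
  let I : Set O := {a | OccursIn a (T.label [])} ∪
    T.witness '' {p ∈ B | ∃ r, T.step p = some r ∧ r.IsEx}
  have hIfin : I.Finite :=
    (finite_occursIn (hT.finite_label hS hT.root_mem)).union (hex.image _)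
  have hI : ∀ p ∈ B, ∀ b, OccursIn b (T.label p) → b ∈ I := by
    intro p
    induction p with
    | nil => exact fun _ b hb => Or.inl hb
    | cons i p ih =>
      rintro hp b ⟨L, hL, hLb⟩
      have hpB := hB.parent_mem i p hp
      obtain ⟨hp', r, X, hr, hX, hl⟩ := hT.exists_of_cons_mem (hB.subset hp)
      rw [hl] at hL
      rcases hL with hL | hL
      · exact ih hpB b ⟨L, hL, hLb⟩
      · rcases RuleInst.occursIn_of_mem_conclusions hX ⟨L, hL, hLb⟩ with h | ⟨hr', rfl, -⟩
        · exact ih hpB b (h.mono (hT.applicable p hp' r hr).1)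
        · exact Or.inr ⟨p, ⟨hpB, r, hr, hr'⟩, rfl⟩
  have hcontent : (T.content B).Finite := by
    refine ((hIfin.prod (finite_extend hΓfin hIfin)).image
      fun x : O × Concept O A Q => x.1 ⦂ x.2).subset ?_
    rintro ⟨a, C⟩ ⟨p, hp, hL⟩
    exact ⟨(a, C), ⟨hI p hp a ⟨_, hL, Or.inl rfl⟩,
      con_mem_extend hT hΓ hroot (hB.subset hp) _ hL,
      fun b hb => hI p hp b ⟨_, hL, Or.inr hb⟩⟩, rfl⟩
  have h1 : {p ∈ B | ∃ r, T.step p = some r}.Finite := by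
    refine Set.Finite.of_finite_image (f := T.step)
      (((RuleInst.finite_premises_subset hcontent).image some).subset ?_) ?_
    · rintro _ ⟨p, ⟨hp, r, hr⟩, rfl⟩
      exact ⟨r, fun L hL => ⟨p, hp, (hT.applicable p (hB.subset hp) r hr).1 hL⟩, hr.symm⟩
    · rintro p ⟨hp, r, hr⟩ q ⟨hq, -⟩ h
      exact hT.eq_of_step_eq hB hp hq hr (h ▸ hr)
  -- a branch has at most one node which is not expanded
  have h2 : {p ∈ B | T.step p = none}.Finite := by
    have key : ∀ p ∈ B, ∀ q ∈ B, T.step p = none → p <:+ q → p = q := by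
      intro p hp q hq hpn
      induction q with
      | nil => exact List.suffix_nil.1
      | cons i q ih =>
        intro h
        rcases List.suffix_cons_iff.1 h with h | h
        · exact h
        · obtain rfl := ih (hB.parent_mem i q hq) h
          obtain ⟨-, r, X, hr, -⟩ := hT.exists_of_cons_mem (hB.subset hq)
          rw [hpn] at hr
          cases hr
    refine Set.Subsingleton.finite ?_
    rintro p ⟨hp, hpn⟩ q ⟨hq, hqn⟩
    exact (hB.suffix_total hp hq).elim (key p hp q hq hpn) fun h => (key q hq p hp hqn h).symm
  refine (h1.union h2).subset fun p hp => ?_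
  cases h : T.step p with
  | none => exact Or.inr ⟨hp, h⟩
  | some r => exact Or.inl ⟨hp, r, h⟩

/-! ### Closed tableaux -/

/-- An infinite derivation has an infinite branch, by König's lemma, and an infinite branch
is open. -/
theorem finite_nodes_of_closed (hT : T.IsDerivation S) (hclosed : T.Closed) : T.nodes.Finite := by
  by_contra hinf
  let D : Pos → Set Pos := fun p => {q ∈ T.nodes | p <:+ q}
  have hstep : ∀ p, (D p).Infinite → ∃ i, (D (i :: p)).Infinite := by
    intro p hp
    by_contra! h
    apply hp
    cases hs : T.step p with
    | none =>
      refine (Set.finite_singleton p).subset ?_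
      rintro q ⟨hq, t, rfl⟩
      induction t using List.reverseRecOn with
      | nil => rfl
      | append_singleton t i =>
        have := (hT.mem_of_suffix (p := i :: p) hq ⟨t, by simp⟩).1
        obtain ⟨-, r, X, hr, -⟩ := hT.exists_of_cons_mem this
        rw [hs] at hr
        cases hr
    | some r =>
      refine ((Set.finite_singleton p).union
        ((Set.finite_lt_nat (r.conclusions (T.witness p)).length).biUnion
          fun i _ => h i)).subset ?_
      rintro q ⟨hq, t, rfl⟩
      induction t using List.reverseRecOn with
      | nil => exact Or.inl rfl
      | append_singleton t i =>
        have hsuf : i :: p <:+ t ++ [i] ++ p := ⟨t, by simp⟩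
        obtain ⟨-, r', hr', hi⟩ := (hT.children p i).1 (hT.mem_of_suffix hq hsuf).1
        obtain rfl := Option.some.inj (hs.symm.trans hr')
        exact Or.inr (Set.mem_biUnion hi ⟨hq, hsuf⟩)
  choose! c hc using hstep
  let f : ℕ → Pos := fun n => Nat.rec [] (fun _ p => c p :: p) n
  have f_succ : ∀ n, f (n + 1) = c (f n) :: f n := fun _ => rfl
  have hf : ∀ n, (D (f n)).Infinite := by
    intro n
    induction n with
    | zero =>
      have : D [] = T.nodes := by ext q; simp [D]
      exact this ▸ hinf
    | succ n ih => exact hc _ ih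
  have hmem : ∀ n, f n ∈ T.nodes := fun n => by
    obtain ⟨q, hq, hnq⟩ := (hf n).nonempty
    exact (hT.mem_of_suffix hq hnq).1
  have hlen : ∀ n, (f n).length = n := by
    intro n
    induction n with
    | zero => rfl
    | succ n ih => rw [f_succ, List.length_cons, ih]
  have hB : T.IsBranch (Set.range f) := by
    refine ⟨?_, ⟨0, rfl⟩, ?_, ?_, ?_⟩
    · rintro _ ⟨n, rfl⟩
      exact hmem n
    · rintro i p ⟨_ | n, hn⟩
      · cases hn
      · rw [f_succ] at hn
        exact ⟨n, (List.cons.inj hn).2⟩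
    · rintro i j p ⟨m, hm⟩ ⟨n, hn⟩
      have h1 := hlen m
      have h2 := hlen n
      rw [hm, List.length_cons] at h1
      rw [hn, List.length_cons] at h2
      obtain rfl := h1.symm.trans h2
      exact (List.cons.inj (hm.symm.trans hn)).1
    · rintro i _ ⟨n, rfl⟩ -
      exact ⟨_, n + 1, f_succ n⟩
  obtain ⟨_, ⟨n, rfl⟩, r, hr, hrc⟩ := hclosed _ hB
  obtain ⟨-, r', X, hr', hX, -⟩ := hT.exists_of_cons_mem (f_succ n ▸ hmem (n + 1))
  obtain rfl := Option.some.inj (hr.symm.trans hr')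
  cases r with
  | clash a C => simp [RuleInst.conclusions] at hX
  | _ => exact hrc.elim

end Tableau

end

end ALBO

theorem mainTheorem1 {O A Q : Type*} :
    ALBO.Terminating (ALBO.TableauCalculusUB (O := O) (A := A) (Q := Q)) := by
  open ALBO ALBO.Tableau in
  intro S hS T hT
  have hD := hT.derivation
  refine ⟨finite_nodes_of_closed hD, fun hopen => ?_⟩
  obtain ⟨B₀, hB₀, hB₀open⟩ : ∃ B, T.IsBranch B ∧ ¬ T.ClosedBranch B := by
    simpa [Tableau.Closed] using hopen
  obtain ⟨lt₀, hlt₀, -, hexp⟩ := hT.c1_and_expanded B₀ hB₀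
  have hH₀ := hintikka_content hD hS hB₀ hlt₀ hB₀open (hexp hB₀open)
  obtain ⟨Γ, hΓfin, hΓ, hSΓ⟩ := exists_finite_subClosed (hS.image Concept.preprocess)
  have hroot : ∀ L ∈ T.label [], L.con ∈ Γ := by
    obtain ⟨a, -, h⟩ := hD.root_label
    rw [h]
    rintro _ ⟨C, hC, rfl⟩
    exact hSΓ ⟨C, hC, rfl⟩
  obtain ⟨O', σ₀, H, hH, hfin, hσ₀⟩ := hH₀.exists_finite hΓfin hΓ
  obtain ⟨B, hB, σ, hσ⟩ := exists_guided_branch hD hH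
    fun L hL => hσ₀ L ⟨[], hB₀.root_mem, hL⟩ (hroot L hL)
  have hBopen := not_closedBranch hD hB hH hσ
  obtain ⟨lt, hlt, hc1, -⟩ := hT.c1_and_expanded B hB
  exact ⟨B, hB, hBopen, finite_of_finite_isEx hD hS hB
    (finite_isEx hD hS hB hH hfin hσ hlt hc1 (hT.c2 B hB hBopen) hΓfin hΓ hroot)
    hΓfin hΓ hroot⟩
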